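/- Let $(M_p)_{p\in\mathbb N}$ be a sequence of positive numbers with $M_0=1$ such that (M.1) $M_p^2\le M_{p-1}M_{p+1}$ for $p\ge 1$; (M.2) $M_p\le c_0H^p\min_{0\le q\le p}M_{p-q}M_q$ for $p\in\mathbb N$, with some $c_0,H\ge 1$; (M.3) $\sum_{p=q+1}^\infty M_{p-1}/M_p\le c_0\,q\,M_q/M_{q+1}$ for $q\ge 1$, with some $c_0\ge 1$. Put $M(\rho)=\sup_{p}\log_+(\rho^p/M_p)$ for $\rho\ge 0$ and $\langle x\rangle=(1+|x|^2)^{1/2}$. The symbol $*$ stands for $(M_p)$ (Beurling case) or $\{M_p\}$ (Roumieu case). $\mathcal D^*(\mathbb R^d)$ is the space of compactly supported $\varphi\in C^\infty(\mathbb R^d)$ such that $\|\varphi\|_h=\sup_{\alpha,x}|D^\alpha\varphi(x)|/(h^{|\alpha|}M_{|\alpha|})$ is finite for every $h>0$ in the Beurling case, resp. for some $h>0$ in the Roumieu case. $\mathcal D'^*(\mathbb R^d)$ consists of the linear functionals $S$ on $\mathcal D^*$ that are continuous, i.e. for every compact $K$ there are $h>0$ and $C$, resp. for every compact $K$ and every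 $h>0$ there is $C$, such that $|\langle S,\varphi\rangle|\le C\|\varphi\|_h$ for all $\varphi\in\mathcal D^*$ supported in $K$ with $\|\varphi\|_h<\infty$. $\mathcal S^*(\mathbb R^d)$ is the space of $\varphi\in C^\infty(\mathbb R^d)$ such that $\sigma_m(\varphi)=\sup_{\alpha,\beta,x}m^{|\alpha|+|\beta|}\langle x\rangle^{|\alpha|}|D^\beta\varphi(x)|/(M_{|\alpha|}M_{|\beta|})$ is finite for every $m>0$, resp. for some $m>0$. $\mathcal S'^*(\mathbb R^d)$ consists of the linear functionals $T$ on $\mathcal S^*$ that are continuous, i.e. for some $m>0$, resp. for every $m>0$, there is $C$ such that $|\langle T,\varphi\rangle|\le C\sigma_m(\varphi)$ for all $\varphi\in\mathcal S^*$ with $\sigma_m(\varphi)<\infty$. The Fourier transform on $\mathcal S'^*$ is $\langle\mathcal F T,\psi\rangle=\langle T,\mathcal F\psi\rangle$ with $\mathcal F\psi(x)=\int_{\mathbb R^d}e^{-ix\eta}\psi(\eta)\,d\eta$. Theorem. Let $B\subseteq\mathbb R^d$ be a connected open set and let $f$ be an analytic function on $B+i\mathbb R^d\subseteq\mathbb C^d$.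 Suppose that for every compact $K\subset B$ there exist $C>0$ and $k>0$ (Beurling case), resp. for every compact $K\subset B$ and every $k>0$ there exists $C>0$ (Roumieu case), such that $$|f(\xi+i\eta)|\le C e^{M(k|\eta|)}\qquad\text{for all }\xi\in K,\ \eta\in\mathbb R^d.$$ Then there exists $S\in\mathcal D'^*(\mathbb R^d)$ such that $e^{-x\xi}S(x)\in\mathcal S'^*(\mathbb R^d)$ for all $\xi\in B$ (that is, $\varphi\mapsto\langle S,e^{-x\xi}\varphi\rangle$ extends from $\mathcal D^*$ to an element of $\mathcal S'^*$), and its Laplace transform is $f$: $$\mathcal F_{x\to\eta}\bigl(e^{-x\xi}S(x)\bigr)(\eta)=f(\xi+i\eta),\qquad \xi\in B,\ \eta\in\mathbb R^d,$$ i.e. for each $\xi\in B$ the tempered ultradistribution $\mathcal F(e^{-x\xi}S)$ is the continuous function $\eta\mapsto f(\xi+i\eta)$, with $\langle\mathcal F(e^{-x\xi}S),\psi\rangle=\int_{\mathbb R^d}f(\xi+i\eta)\psi(\eta)\,d\eta$ (absolutely convergent) for all $\psi\in\mathcal S^*$. -/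

import Mathlib

open MeasureTheory
open scoped ContDiff

noncomputable section

namespace Ultra

/-- The space `ℝ^d` with its Euclidean norm. -/
abbrev Rd (d : ℕ) : Type := EuclideanSpace ℝ (Fin d)

/-- A sequence `M_p` of positive numbers with `M_0 = 1` satisfying the conditions
(M.1), (M.2) and (M.3) of Komatsu. -/
structure WeightSequence where
  /-- The underlying sequence. -/
  seq : ℕ → ℝ
  pos : ∀ p, 0 < seq p
  zero : seq 0 = 1
  /-- (M.1), for `p ≥ 1`. -/
  m1 : ∀ p, 1 ≤ p → seq p ^ 2 ≤ seq (p - 1) * seq (p + 1)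
  /-- (M.2): stability under ultradifferential operators. -/
  m2 : ∃ c₀ H : ℝ, 1 ≤ c₀ ∧ 1 ≤ H ∧
    ∀ p q, q ≤ p → seq p ≤ c₀ * H ^ p * (seq (p - q) * seq q)
  /-- (M.3): strong non-quasianalyticity. The series is indexed by `p = q + 1 + j`, `j ≥ 0`. -/
  m3 : ∃ c₀ : ℝ, 1 ≤ c₀ ∧ ∀ q, 1 ≤ q →
    Summable (fun j : ℕ => seq (q + j) / seq (q + j + 1)) ∧
    ∑' j : ℕ, seq (q + j) / seq (q + j + 1) ≤ c₀ * q * (seq q / seq (q + 1))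

/-- The associated function `M(ρ) = sup_p log₊ (ρ^p / M_p)`. The supremum is finite because
`M_p / M_{p-1} → ∞` by (M.1) and (M.3). -/
def WeightSequence.assoc (M : WeightSequence) (ρ : ℝ) : ℝ :=
  ⨆ p : ℕ, Real.posLog (ρ ^ p / M.seq p)

/-- The two cases `* = (M_p)` (Beurling) and `* = {M_p}` (Roumieu). -/
inductive Kind
  | beurling
  | roumieu

variable {d : ℕ}

/-- The partial derivative `∂_{a_1} ⋯ ∂_{a_n} φ (x)`. When `a` runs over all words of length `n` in
the indices of the coordinates, this runs over all `∂^α φ (x)` with `|α| = n`. -/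
def pderiv {n : ℕ} (a : Fin n → Fin d) (φ : Rd d → ℂ) (x : Rd d) : ℂ :=
  iteratedFDeriv ℝ n φ x (fun i => EuclideanSpace.single (a i) (1 : ℝ))

/-- `sup_{α, x} |D^α φ(x)| / (h^{|α|} M_{|α|}) ≤ A`. -/
def DNormLE (M : WeightSequence) (h A : ℝ) (φ : Rd d → ℂ) : Prop :=
  ∀ (n : ℕ) (a : Fin n → Fin d) (x : Rd d), ‖pderiv a φ x‖ ≤ A * (h ^ n * M.seq n)

/-- `sup_{α, β, x} m^{|α|+|β|} ⟨x⟩^{|α|} |D^β φ(x)| / (M_{|α|} M_{|β|}) ≤ A`, where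
`⟨x⟩ = (1 + |x|²)^{1/2}`; that is, `σ_{m,∞}(φ) ≤ A`. -/
def SNormLE (M : WeightSequence) (m A : ℝ) (φ : Rd d → ℂ) : Prop :=
  ∀ (p n : ℕ) (a : Fin n → Fin d) (x : Rd d),
    m ^ (p + n) * Real.sqrt (1 + ‖x‖ ^ 2) ^ p * ‖pderiv a φ x‖ ≤ A * (M.seq p * M.seq n)

/-- The regularity required of the elements of `D^*`: the norm is finite for every `h > 0`
(Beurling), for some `h > 0` (Roumieu). -/
def DFinite (M : WeightSequence) (t : Kind) (φ : Rd d → ℂ) : Prop :=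
  match t with
  | .beurling => ∀ h : ℝ, 0 < h → ∃ A, DNormLE M h A φ
  | .roumieu => ∃ h : ℝ, 0 < h ∧ ∃ A, DNormLE M h A φ

/-- The regularity and decay required of the elements of `S^*`: the norm is finite for every
`m > 0` (Beurling), for some `m > 0` (Roumieu). -/
def SFinite (M : WeightSequence) (t : Kind) (φ : Rd d → ℂ) : Prop :=
  match t with
  | .beurling => ∀ m : ℝ, 0 < m → ∃ A, SNormLE M m A φ
  | .roumieu => ∃ m : ℝ, 0 < m ∧ ∃ A, SNormLE M m A φ

theorem pderiv_add {n : ℕ} (a : Fin n → Fin d) {φ ψ : Rd d → ℂ} (hφ : ContDiff ℝ ∞ φ)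
    (hψ : ContDiff ℝ ∞ ψ) (x : Rd d) : pderiv a (φ + ψ) x = pderiv a φ x + pderiv a ψ x := by
  have h1 : ContDiff ℝ n φ := hφ.of_le (by exact_mod_cast le_top)
  have h2 : ContDiff ℝ n ψ := hψ.of_le (by exact_mod_cast le_top)
  simp [pderiv, iteratedFDeriv_add_apply h1.contDiffAt h2.contDiffAt]

theorem pderiv_smul {n : ℕ} (a : Fin n → Fin d) (c : ℂ) {φ : Rd d → ℂ} (hφ : ContDiff ℝ ∞ φ)
    (x : Rd d) : pderiv a (c • φ) x = c * pderiv a φ x := by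
  have h1 : ContDiff ℝ n φ := hφ.of_le (by exact_mod_cast le_top)
  simp [pderiv, iteratedFDeriv_const_smul_apply h1.contDiffAt]

theorem pderiv_zero {n : ℕ} (a : Fin n → Fin d) (x : Rd d) :
    pderiv a (0 : Rd d → ℂ) x = 0 := by
  have := pderiv_smul a 0 (φ := (0 : Rd d → ℂ)) contDiff_const x
  simpa using this

theorem DNormLE.nonneg {M : WeightSequence} {h A : ℝ} {φ : Rd d → ℂ} (H : DNormLE M h A φ) :
    0 ≤ A := by
  have := (norm_nonneg _).trans (H 0 Fin.elim0 0)
  simpa [M.zero] using this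

theorem DNormLE.mono {M : WeightSequence} {h h' A : ℝ} {φ : Rd d → ℂ} (H : DNormLE M h A φ)
    (h0 : 0 < h) (hh : h ≤ h') : DNormLE M h' A φ := by
  intro n a x
  refine (H n a x).trans ?_
  have := H.nonneg
  have := (M.pos n).le
  gcongr

theorem SNormLE.mono {M : WeightSequence} {m m' A : ℝ} {φ : Rd d → ℂ} (H : SNormLE M m A φ)
    (h0 : 0 < m') (hh : m' ≤ m) : SNormLE M m' A φ := by
  intro p n a x
  refine le_trans ?_ (H p n a x)
  gcongr

theorem DNormLE.add {M : WeightSequence} {h A A' : ℝ} {φ ψ : Rd d → ℂ} (hφ : ContDiff ℝ ∞ φ)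
    (hψ : ContDiff ℝ ∞ ψ) (H : DNormLE M h A φ) (H' : DNormLE M h A' ψ) :
    DNormLE M h (A + A') (φ + ψ) := by
  intro n a x
  rw [pderiv_add a hφ hψ, add_mul]
  exact (norm_add_le _ _).trans (add_le_add (H n a x) (H' n a x))

theorem SNormLE.add {M : WeightSequence} {m A A' : ℝ} {φ ψ : Rd d → ℂ} (hφ : ContDiff ℝ ∞ φ)
    (hψ : ContDiff ℝ ∞ ψ) (hm : 0 < m) (H : SNormLE M m A φ) (H' : SNormLE M m A' ψ) :
    SNormLE M m (A + A') (φ + ψ) := by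
  intro p n a x
  rw [pderiv_add a hφ hψ, add_mul]
  refine le_trans ?_ (add_le_add (H p n a x) (H' p n a x))
  rw [← mul_add]
  gcongr
  exact norm_add_le _ _

theorem DNormLE.smul {M : WeightSequence} {h A : ℝ} {φ : Rd d → ℂ} (hφ : ContDiff ℝ ∞ φ)
    (c : ℂ) (H : DNormLE M h A φ) : DNormLE M h (‖c‖ * A) (c • φ) := by
  intro n a x
  rw [pderiv_smul a c hφ, norm_mul, mul_assoc]
  exact mul_le_mul_of_nonneg_left (H n a x) (norm_nonneg c)

theorem SNormLE.smul {M : WeightSequence} {m A : ℝ} {φ : Rd d → ℂ} (hφ : ContDiff ℝ ∞ φ)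
    (c : ℂ) (H : SNormLE M m A φ) : SNormLE M m (‖c‖ * A) (c • φ) := by
  intro p n a x
  rw [pderiv_smul a c hφ, norm_mul, mul_assoc ‖c‖]
  refine le_trans (le_of_eq ?_) (mul_le_mul_of_nonneg_left (H p n a x) (norm_nonneg c))
  ring

theorem DNormLE.zero (M : WeightSequence) (h : ℝ) : DNormLE M h 0 (0 : Rd d → ℂ) := by
  intro n a x
  simp [pderiv_zero]

theorem SNormLE.zero (M : WeightSequence) (m : ℝ) : SNormLE M m 0 (0 : Rd d → ℂ) := by
  intro p n a x
  simp [pderiv_zero]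

/-- The space `D^*(ℝ^d)` of compactly supported ultradifferentiable functions. -/
def DSpace (M : WeightSequence) (t : Kind) (d : ℕ) : Submodule ℂ (Rd d → ℂ) where
  carrier := {φ | ContDiff ℝ ∞ φ ∧ HasCompactSupport φ ∧ DFinite M t φ}
  add_mem' := by
    rintro φ ψ ⟨h1, h2, h3⟩ ⟨k1, k2, k3⟩
    refine ⟨h1.add k1, h2.add k2, ?_⟩
    cases t with
    | beurling =>
      intro h hh
      obtain ⟨A, hA⟩ := h3 h hh
      obtain ⟨A', hA'⟩ := k3 h hh
      exact ⟨_, hA.add h1 k1 hA'⟩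
    | roumieu =>
      obtain ⟨h, hh, A, hA⟩ := h3
      obtain ⟨h', hh', A', hA'⟩ := k3
      exact ⟨max h h', lt_max_of_lt_left hh, _,
        (hA.mono hh (le_max_left _ _)).add h1 k1 (hA'.mono hh' (le_max_right _ _))⟩
  zero_mem' := by
    refine ⟨contDiff_const, HasCompactSupport.zero, ?_⟩
    cases t with
    | beurling => exact fun h _ => ⟨0, DNormLE.zero M h⟩
    | roumieu => exact ⟨1, one_pos, 0, DNormLE.zero M 1⟩
  smul_mem' := by
    rintro c φ ⟨h1, h2, h3⟩
    refine ⟨h1.const_smul c, h2.smul_left (f := fun _ => c), ?_⟩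
    cases t with
    | beurling =>
      intro h hh
      obtain ⟨A, hA⟩ := h3 h hh
      exact ⟨_, hA.smul h1 c⟩
    | roumieu =>
      obtain ⟨h, hh, A, hA⟩ := h3
      exact ⟨h, hh, _, hA.smul h1 c⟩

/-- The space `S^*(ℝ^d)` of rapidly decreasing ultradifferentiable functions. -/
def SSpace (M : WeightSequence) (t : Kind) (d : ℕ) : Submodule ℂ (Rd d → ℂ) where
  carrier := {φ | ContDiff ℝ ∞ φ ∧ SFinite M t φ}
  add_mem' := by
    rintro φ ψ ⟨h1, h3⟩ ⟨k1, k3⟩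
    refine ⟨h1.add k1, ?_⟩
    cases t with
    | beurling =>
      intro h hh
      obtain ⟨A, hA⟩ := h3 h hh
      obtain ⟨A', hA'⟩ := k3 h hh
      exact ⟨_, hA.add h1 k1 hh hA'⟩
    | roumieu =>
      obtain ⟨h, hh, A, hA⟩ := h3
      obtain ⟨h', hh', A', hA'⟩ := k3
      have h0 := lt_min hh hh'
      exact ⟨min h h', h0, _,
        (hA.mono h0 (min_le_left _ _)).add h1 k1 h0 (hA'.mono h0 (min_le_right _ _))⟩
  zero_mem' := by
    refine ⟨contDiff_const, ?_⟩
    cases t with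
    | beurling => exact fun h _ => ⟨0, SNormLE.zero M h⟩
    | roumieu => exact ⟨1, one_pos, 0, SNormLE.zero M 1⟩
  smul_mem' := by
    rintro c φ ⟨h1, h3⟩
    refine ⟨h1.const_smul c, ?_⟩
    cases t with
    | beurling =>
      intro h hh
      obtain ⟨A, hA⟩ := h3 h hh
      exact ⟨_, hA.smul h1 c⟩
    | roumieu =>
      obtain ⟨h, hh, A, hA⟩ := h3
      exact ⟨h, hh, _, hA.smul h1 c⟩

/-- Continuity of a linear functional on `D^*`. By the definition of inductive and projective limit
topologies it means: on the functions supported in a given compact set `K`, the functional is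
bounded with respect to the norm with index `h`, for some `h > 0` (Beurling, where
`D_K = proj lim_{h → 0} D_K^h`), for every `h > 0` (Roumieu, where
`D_K = ind lim_{h → ∞} D_K^h`). -/
def DContinuous (M : WeightSequence) (t : Kind) (u : DSpace M t d →ₗ[ℂ] ℂ) : Prop :=
  match t with
  | .beurling => ∀ K : Set (Rd d), IsCompact K → ∃ h : ℝ, 0 < h ∧ ∃ C : ℝ,
      ∀ φ : DSpace M .beurling d, tsupport (φ : Rd d → ℂ) ⊆ K →
        ∀ A, DNormLE M h A (φ : Rd d → ℂ) → ‖u φ‖ ≤ C * A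
  | .roumieu => ∀ K : Set (Rd d), IsCompact K → ∀ h : ℝ, 0 < h → ∃ C : ℝ,
      ∀ φ : DSpace M .roumieu d, tsupport (φ : Rd d → ℂ) ⊆ K →
        ∀ A, DNormLE M h A (φ : Rd d → ℂ) → ‖u φ‖ ≤ C * A

/-- Continuity of a linear functional on `S^*`: boundedness with respect to the norm with index
`m`, for some `m > 0` (Beurling, where `S^* = proj lim_{m → ∞} S^m`), for every `m > 0` (Roumieu,
where `S^* = ind lim_{m → 0} S^m`). -/
def SContinuous (M : WeightSequence) (t : Kind) (u : SSpace M t d →ₗ[ℂ] ℂ) : Prop :=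
  match t with
  | .beurling => ∃ m : ℝ, 0 < m ∧ ∃ C : ℝ,
      ∀ φ : SSpace M .beurling d, ∀ A, SNormLE M m A (φ : Rd d → ℂ) → ‖u φ‖ ≤ C * A
  | .roumieu => ∀ m : ℝ, 0 < m → ∃ C : ℝ,
      ∀ φ : SSpace M .roumieu d, ∀ A, SNormLE M m A (φ : Rd d → ℂ) → ‖u φ‖ ≤ C * A

/-- The ultradistributions `D'^*(ℝ^d)`. -/
structure Ultradistribution (M : WeightSequence) (t : Kind) (d : ℕ) where
  /-- The functional on test functions. -/
  toFun : DSpace M t d →ₗ[ℂ] ℂ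
  cont : DContinuous M t toFun

/-- The tempered ultradistributions `S'^*(ℝ^d)`. -/
structure TemperedUltradistribution (M : WeightSequence) (t : Kind) (d : ℕ) where
  /-- The functional on test functions. -/
  toFun : SSpace M t d →ₗ[ℂ] ℂ
  cont : SContinuous M t toFun

/-- The function `x ↦ e^{-x·ξ} φ(x)`. -/
def expMul (ξ : Rd d) (φ : Rd d → ℂ) : Rd d → ℂ :=
  fun x => (Real.exp (-inner ℝ x ξ) : ℂ) * φ x

/-- The ultradistribution `e^{-x·ξ} S` is (the restriction to `D^*` of) the tempered
ultradistribution `T`: `⟨T, φ⟩ = ⟨S, e^{-x·ξ} φ⟩` for every `φ ∈ D^*`. That `D^* ⊆ S^*` and that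
`D^*` is stable under multiplication by `e^{-x·ξ}` is part of the assertion. -/
def IsExpMul {M : WeightSequence} {t : Kind} (ξ : Rd d) (S : Ultradistribution M t d)
    (T : TemperedUltradistribution M t d) : Prop :=
  ∀ φ : DSpace M t d, ∃ (h₁ : (φ : Rd d → ℂ) ∈ SSpace M t d)
    (h₂ : expMul ξ (φ : Rd d → ℂ) ∈ DSpace M t d), T.toFun ⟨φ, h₁⟩ = S.toFun ⟨_, h₂⟩

/-- The Fourier transform `(F ψ)(x) = ∫ e^{-i x·η} ψ(η) dη`. -/
def fourier (ψ : Rd d → ℂ) (x : Rd d) : ℂ :=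
  ∫ η : Rd d, Complex.exp (-Complex.I * ((inner ℝ x η : ℝ) : ℂ)) * ψ η

/-- The Fourier transform of the tempered ultradistribution `T`, given by `⟨F T, ψ⟩ = ⟨T, F ψ⟩`, is
the continuous function `g`, i.e. `⟨T, F ψ⟩ = ∫ g(η) ψ(η) dη` for all `ψ ∈ S^*`. That the integral
converges and that `S^*` is stable under the Fourier transform is part of the assertion. -/
def FourierEq {M : WeightSequence} {t : Kind} (T : TemperedUltradistribution M t d)
    (g : Rd d → ℂ) : Prop :=
  Continuous g ∧ ∀ ψ : SSpace M t d,
    Integrable (fun η => g η * (ψ : Rd d → ℂ) η) ∧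
    ∃ h : fourier (ψ : Rd d → ℂ) ∈ SSpace M t d,
      T.toFun ⟨_, h⟩ = ∫ η : Rd d, g η * (ψ : Rd d → ℂ) η

/-- The point `ξ + i η` of `ℂ^d`. -/
def cpoint (ξ η : Rd d) : Fin d → ℂ := fun j => (ξ j : ℂ) + Complex.I * (η j : ℂ)

/-- The tube `B + i ℝ^d`. -/
def tube (B : Set (Rd d)) : Set (Fin d → ℂ) := {z | ∃ ξ ∈ B, ∃ η : Rd d, z = cpoint ξ η}

/-- The growth condition `|f(ξ + iη)| ≤ C e^{M(k|η|)}` for `ξ ∈ K`, `η ∈ ℝ^d`, on every compact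
`K ⊆ B`, with some `k` (Beurling), with every `k` and `C` depending on `k` (Roumieu). -/
def GrowthCondition (M : WeightSequence) (t : Kind) (B : Set (Rd d)) (f : (Fin d → ℂ) → ℂ) :
    Prop :=
  match t with
  | .beurling => ∀ K : Set (Rd d), IsCompact K → K ⊆ B → ∃ C k : ℝ, 0 < C ∧ 0 < k ∧
      ∀ ξ ∈ K, ∀ η : Rd d, ‖f (cpoint ξ η)‖ ≤ C * Real.exp (M.assoc (k * ‖η‖))
  | .roumieu => ∀ K : Set (Rd d), IsCompact K → K ⊆ B → ∀ k : ℝ, 0 < k → ∃ C : ℝ, 0 < C ∧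
      ∀ ξ ∈ K, ∀ η : Rd d, ‖f (cpoint ξ η)‖ ≤ C * Real.exp (M.assoc (k * ‖η‖))

end Ultra

end

noncomputable section

namespace Ultra

/-! For fixed ξ ∈ B the tempered ultradistribution with Fourier transform f(ξ + i·) must be T_ξ(φ) =
∫ f(ξ + iη) (F⁻¹φ)(η) dη, so S has to be φ ↦ T_ξ(e^{x·ξ} φ). The proof defines S by this formula at
one base point ξ₀ and shows that the choice of the point does not matter.

Convergence and continuity come from estimates on S^*. The Fourier transform maps the norm of index
m boundedly into the norm of index cm, with c independent of m (`exists_sOpNormLE_fourier`). The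
decay encoded in that norm beats e^{M(k|η|)} for a matching k and leaves an integrable factor
⟨η⟩^{-(d+1)} (`exists_bracket_pow_mul_exp_assoc_le`). The indices correspond linearly, so one
argument serves both the Beurling and the Roumieu quantifiers. Fourier stability rests on i! R^i ≤ C
M_i²: in the Leibniz formula for D^p(v^n φ), differentiating v^n produces i! times a binomial
coefficient, while n and p each drop by i, and M_i M_{n-i} ≤ M_n, M_i M_{p-i} ≤ M_p pay for the
factorial. Fourier inversion then identifies F T_ξ with f(ξ + i·).

Independence of ξ is a contour shift (`integral_cpoint_add_eq`). For φ ∈ D^* the integrand is G(ξ +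
iη), where G is f times a constant times the entire Laplace transform of φ. The function w ↦ ∫ G(ξ +
wv + iη) dη is holomorphic, and by translation invariance in η it depends only on Re w, so it is
constant. Hence the integral is locally constant in ξ, and it is constant because B is connected
(`laplace_integral_eq`). -/

theorem exists_forall_le_of_tendsto_ratio {u r : ℕ → ℝ} (hu : ∀ k, 0 ≤ u k)
    (h : ∀ k, u (k + 1) ≤ r k * u k) (hr : Filter.Tendsto r Filter.atTop (nhds 0)) :
    ∃ C, 0 < C ∧ ∀ k, u k ≤ C := by
  obtain ⟨N, hN⟩ := Filter.eventually_atTop.1 (hr.eventually (gt_mem_nhds one_pos))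
  -- From N on the ratios are below 1, so u does not increase there; the sum dominates every earlier
  -- term, and the 1 only makes the constant positive.
  refine ⟨1 + ∑ j ∈ Finset.range (N + 1), u j,
    add_pos_of_pos_of_nonneg one_pos (Finset.sum_nonneg fun j _ => hu j), fun k => ?_⟩
  have key : ∀ k ≤ N, u k ≤ ∑ j ∈ Finset.range (N + 1), u j := fun k hk =>
    Finset.single_le_sum (f := u) (fun j _ => hu j) (Finset.mem_range.2 (by omega))
  rcases le_total k N with hk | hk
  · linarith [key k hk]
  · induction k, hk using Nat.le_induction with
    | base => linarith [key N le_rfl]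
    | succ k hk ih =>
      refine ((h k).trans ?_).trans ih
      nlinarith [hN k hk, hu k]

/-! ### Growth of the weight sequence. -/

namespace WeightSequence

variable (M : WeightSequence)

theorem ratio_antitone : Antitone fun j => M.seq j / M.seq (j + 1) := by
  refine antitone_nat_of_succ_le fun p => ?_
  have := M.m1 (p + 1) (by omega)
  rw [div_le_div_iff₀ (M.pos _) (M.pos _)]
  simpa [sq, mul_comm] using this

theorem summable_ratio : Summable fun j => M.seq j / M.seq (j + 1) := by
  obtain ⟨c, -, h⟩ := M.m3
  rw [← summable_nat_add_iff 1]
  simpa [add_comm] using (h 1 le_rfl).1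

/-- Log-convexity with M_0 = 1: the ratios M_k / M_{k+1} decrease, so passing from k to k + 1
enlarges M_{j+k} by at least the factor by which it enlarges M_k. -/
theorem seq_mul_le (j k : ℕ) : M.seq j * M.seq k ≤ M.seq (j + k) := by
  induction k with
  | zero => simp [M.zero]
  | succ k ih =>
    have h := M.ratio_antitone (Nat.le_add_left k j)
    simp only at h
    rw [div_le_div_iff₀ (M.pos _) (M.pos _)] at h
    refine le_of_mul_le_mul_left ?_ (M.pos k)
    calc M.seq k * (M.seq j * M.seq (k + 1)) = (M.seq j * M.seq k) * M.seq (k + 1) := by ring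
      _ ≤ M.seq (j + k) * M.seq (k + 1) := by gcongr; exact (M.pos _).le
      _ ≤ _ := h

theorem seq_mul_seq_sub_le {k n : ℕ} (hk : k ≤ n) : M.seq k * M.seq (n - k) ≤ M.seq n := by
  simpa [hk] using M.seq_mul_le k (n - k)

theorem exists_pow_le (R : ℝ) (hR : 0 ≤ R) : ∃ C, 0 < C ∧ ∀ p, R ^ p ≤ C * M.seq p := by
  obtain ⟨C, hC, h⟩ := exists_forall_le_of_tendsto_ratio (u := fun p => R ^ p / M.seq p)
    (r := fun j => R * (M.seq j / M.seq (j + 1)))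
    (fun k => div_nonneg (pow_nonneg hR k) (M.pos k).le)
    (fun k => le_of_eq (by
      have := (M.pos k).ne'
      have := (M.pos (k + 1)).ne'
      field_simp
      ring))
    (by simpa using M.summable_ratio.tendsto_atTop_zero.const_mul R)
  exact ⟨C, hC, fun p => (div_le_iff₀ (M.pos p)).1 (h p)⟩

/-- With a_k = M_k / M_{k+1}, the quotient of consecutive values of k! R^k / M_k² is (k + 1) a_k · R
a_k. The first factor is bounded because a is decreasing and summable, and the second tends to 0.
This is what absorbs the factorials in the Leibniz formula. -/
theorem exists_factorial_mul_pow_le (R : ℝ) (hR : 0 ≤ R) :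
    ∃ C, 0 < C ∧ ∀ k : ℕ, (k.factorial : ℝ) * R ^ k ≤ C * M.seq k ^ 2 := by
  set a := fun j => M.seq j / M.seq (j + 1) with ha
  have ha0 : ∀ j, 0 ≤ a j := fun j => div_nonneg (M.pos _).le (M.pos _).le
  have hka : ∀ k : ℕ, (k + 1 : ℝ) * a k ≤ ∑' j, a j := fun k => by
    refine le_trans ?_ (M.summable_ratio.sum_le_tsum (Finset.range (k + 1)) fun j _ => ha0 j)
    have := Finset.card_nsmul_le_sum (Finset.range (k + 1)) a (a k) fun j hj =>
      M.ratio_antitone (Nat.lt_succ_iff.1 (Finset.mem_range.1 hj))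
    simpa using this
  obtain ⟨C, hC, h⟩ := exists_forall_le_of_tendsto_ratio
    (u := fun k => (k.factorial : ℝ) * R ^ k / M.seq k ^ 2)
    (r := fun k => (∑' j, a j) * R * a k)
    (fun k => div_nonneg (by positivity) (sq_nonneg _))
    (fun k => by
      have h1 := (M.pos k).ne'
      have h2 := (M.pos (k + 1)).ne'
      have : ((k + 1).factorial : ℝ) * R ^ (k + 1) / M.seq (k + 1) ^ 2 =
          ((k + 1 : ℝ) * a k) * R * a k * (k.factorial * R ^ k / M.seq k ^ 2) := by
        simp only [ha, Nat.factorial_succ]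
        push_cast
        field_simp
        ring
      rw [this]
      have := ha0 k
      gcongr
      exact hka k)
    (by simpa using M.summable_ratio.tendsto_atTop_zero.const_mul ((∑' j, a j) * R))
  exact ⟨C, hC, fun p => (div_le_iff₀ (pow_pos (M.pos p) 2)).1 (h p)⟩

/-- After taking logarithms, termwise bounds pass to the supremum. The case p = 0 gives b ≤ A, which
handles the truncation in log₊. -/
theorem exp_assoc_mul_le {ρ b A : ℝ} (hρ : 0 ≤ ρ) (hb : 0 ≤ b)
    (h : ∀ p, ρ ^ p * b ≤ A * M.seq p) : Real.exp (M.assoc ρ) * b ≤ A := by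
  have h0 : b ≤ A := by simpa [M.zero] using h 0
  rcases hb.eq_or_lt with rfl | hb
  · simpa using h0
  have hA : 0 < A / b := div_pos (hb.trans_le h0) hb
  rw [← le_div_iff₀ hb, ← Real.le_log_iff_exp_le hA]
  refine ciSup_le fun p => ?_
  rw [Real.posLog]
  refine max_le (Real.log_nonneg ((one_le_div hb).2 h0)) ?_
  rcases (pow_nonneg hρ p).eq_or_lt with h1 | h1
  · rw [← h1]; simpa using Real.log_nonneg ((one_le_div hb).2 h0)
  · refine Real.log_le_log (div_pos h1 (M.pos p)) ?_
    rw [div_le_div_iff₀ (M.pos p) hb]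
    exact h p

end WeightSequence

end Ultra

/-! ### Leibniz estimate for derivatives of v^n φ. -/

namespace VectorFourier
open ContinuousMultilinearMap Real

set_option maxSynthPendingDepth 3 in
/-- Bound on the iterated derivatives of `fourierPowSMulRight` with the sharp combinatorial
factors. -/
theorem norm_iteratedFDeriv_fourierPowSMulRight_le_sum {V W E : Type*} [NormedAddCommGroup V]
    [NormedSpace ℝ V] [NormedAddCommGroup W] [NormedSpace ℝ W] [NormedAddCommGroup E]
    [NormedSpace ℂ E] (L : V →L[ℝ] W →L[ℝ] ℝ) {f : V → E} {K : ℕ∞ω} (hf : ContDiff ℝ K f)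
    (n : ℕ) {k : ℕ} (hk : k ≤ K) (v : V) :
    ‖iteratedFDeriv ℝ k (fun v ↦ fourierPowSMulRight L f v n) v‖ ≤
      (2 * π * ‖L‖) ^ n * ∑ i ∈ Finset.range (k + 1), (k.choose i * n.descFactorial i : ℝ) *
        (‖v‖ ^ (n - i) * ‖iteratedFDeriv ℝ (k - i) f v‖) := by
  simp_rw [fourierPowSMulRight_eq_comp]
  let T : (W →L[ℝ] ℝ) [×n]→L[ℝ] (W [×n]→L[ℝ] ℝ) :=
    compContinuousLinearMapLRight (ContinuousMultilinearMap.mkPiAlgebra ℝ (Fin n) ℝ)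
  have I₁ m : ‖iteratedFDeriv ℝ m T (fun _ ↦ L v)‖ ≤
      n.descFactorial m * 1 * (‖L‖ * ‖v‖) ^ (n - m) := by
    have : ‖T‖ ≤ 1 := by
      apply (norm_compContinuousLinearMapLRight_le _ _).trans
      simp only [norm_mkPiAlgebra, le_refl]
    apply (ContinuousMultilinearMap.norm_iteratedFDeriv_le _ _ _).trans
    simp only [Fintype.card_fin]
    gcongr
    refine (pi_norm_le_iff_of_nonneg (by positivity)).mpr (fun _ ↦ ?_)
    exact ContinuousLinearMap.le_opNorm _ _
  -- The falling factorial is kept exact: being i! times a binomial coefficient, it can later be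
  -- absorbed by M_i² up to a geometric factor.
  have I₂ m : ‖iteratedFDeriv ℝ m (T ∘ (ContinuousLinearMap.pi (fun (_ : Fin n) ↦ L))) v‖ ≤
      (n.descFactorial m * 1 * (‖L‖ * ‖v‖) ^ (n - m)) * ‖L‖ ^ m := by
    rw [ContinuousLinearMap.iteratedFDeriv_comp_right _ (ContinuousMultilinearMap.contDiff _)
      _ (mod_cast le_top)]
    apply (norm_compContinuousLinearMap_le _ _).trans
    simp only [Finset.prod_const, Finset.card_fin]
    gcongr
    · exact I₁ m
    · exact ContinuousLinearMap.norm_pi_le_of_le (fun _ ↦ le_rfl) (norm_nonneg _)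
  have I₃ m : ‖iteratedFDeriv ℝ m (fun (y : V) ↦ T (fun _ ↦ L y)) v‖ ≤
      n.descFactorial m * ‖L‖ ^ n * ‖v‖ ^ (n - m) := by
    apply (I₂ m).trans (le_of_eq _)
    rcases le_or_gt m n with hm | hm
    · rw [show ‖L‖ ^ n = ‖L‖ ^ (m + (n - m)) by rw [Nat.add_sub_cancel' hm], pow_add]
      ring
    · simp only [Nat.descFactorial_eq_zero_iff_lt.mpr hm, CharP.cast_eq_zero, mul_one, zero_mul]
  have A : ContDiff ℝ K (fun y ↦ T (fun _ ↦ L y)) :=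
    (ContinuousMultilinearMap.contDiff _).comp (contDiff_pi.2 fun _ ↦ L.contDiff)
  rw [iteratedFDeriv_const_smul_apply' (hf := ((smulRightL ℝ (fun _ ↦ W)
    E).isBoundedBilinearMap.contDiff.comp₂ (A.of_le hk) (hf.of_le hk)).contDiffAt),
    norm_smul (β := V [×k]→L[ℝ] (W [×n]→L[ℝ] E)), mul_pow,
    mul_assoc ((2 * π) ^ n)]
  simp only [norm_pow, norm_neg, Complex.norm_mul, Complex.norm_ofNat, Complex.norm_real,
    Real.norm_eq_abs, abs_of_nonneg pi_nonneg, Complex.norm_I, mul_one, smulRightL_apply]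
  gcongr
  apply (ContinuousLinearMap.norm_iteratedFDeriv_le_of_bilinear_of_le_one _ A hf _
    hk ContinuousMultilinearMap.norm_smulRightL_le).trans
  rw [Finset.mul_sum]
  refine Finset.sum_le_sum fun i _ ↦ ?_
  calc (k.choose i : ℝ) * ‖iteratedFDeriv ℝ i (fun (y : V) ↦ T (fun _ ↦ L y)) v‖ *
        ‖iteratedFDeriv ℝ (k - i) f v‖
      ≤ k.choose i * (n.descFactorial i * ‖L‖ ^ n * ‖v‖ ^ (n - i)) *
        ‖iteratedFDeriv ℝ (k - i) f v‖ := by gcongr; exact I₃ i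
    _ = _ := by ring

end VectorFourier

namespace Ultra

/-! ### The bracket, and norms by partial derivatives versus operator norms. -/

variable {d : ℕ}

/-- The Japanese bracket `⟨x⟩ = (1 + |x|²)^{1/2}`. -/
def bracket (x : Rd d) : ℝ := Real.sqrt (1 + ‖x‖ ^ 2)

theorem one_le_bracket (x : Rd d) : 1 ≤ bracket x :=
  Real.one_le_sqrt.2 (by nlinarith [sq_nonneg ‖x‖])

theorem bracket_pos (x : Rd d) : 0 < bracket x := one_pos.trans_le (one_le_bracket x)

theorem bracket_sq (x : Rd d) : bracket x ^ 2 = 1 + ‖x‖ ^ 2 :=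
  Real.sq_sqrt (by positivity)

theorem norm_le_bracket (x : Rd d) : ‖x‖ ≤ bracket x :=
  Real.le_sqrt_of_sq_le (by linarith)

theorem bracket_le_of_norm_le {x : Rd d} {R : ℝ} (h : ‖x‖ ≤ R) : bracket x ≤ 1 + R := by
  have := norm_nonneg x
  exact Real.sqrt_le_iff.2 ⟨by linarith, by nlinarith⟩

theorem bracket_le_two_mul_norm {x : Rd d} (h : 1 ≤ ‖x‖) : bracket x ≤ 2 * ‖x‖ :=
  Real.sqrt_le_iff.2 ⟨by linarith, by nlinarith⟩

theorem bracket_le_mul_bracket_add (x y : Rd d) :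
    bracket x ≤ (1 + ‖y‖) * bracket (x + y) := by
  have h1 := one_le_bracket (x + y)
  have h2 := norm_le_bracket (x + y)
  have h3 := bracket_sq (x + y)
  have h4 := norm_nonneg y
  have h5 : ‖x‖ ≤ ‖x + y‖ + ‖y‖ := norm_le_add_norm_add x y
  have h6 : bracket x ≤ bracket (x + y) + ‖y‖ := by
    refine Real.sqrt_le_iff.2 ⟨by linarith, ?_⟩
    have := pow_le_pow_left₀ (norm_nonneg x) h5 2
    nlinarith
  nlinarith

theorem integrable_inv_bracket_pow : Integrable fun x : Rd d => (bracket x ^ (d + 1))⁻¹ := by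
  refine (integrable_rpow_neg_one_add_norm_sq (E := Rd d) (μ := volume) (r := d + 1)
    (by simp)).congr (Filter.Eventually.of_forall fun x => ?_)
  have h : 0 ≤ 1 + ‖x‖ ^ 2 := by positivity
  simp only [bracket, Real.sqrt_eq_rpow]
  rw [← Real.rpow_mul_natCast h, ← Real.rpow_neg h]
  congr 1
  push_cast
  ring

/-- The analogue of `SNormLE` for the operator norms of the iterated derivatives. -/
def SOpNormLE (M : WeightSequence) (m A : ℝ) (φ : Rd d → ℂ) : Prop :=
  ∀ (p n : ℕ) (x : Rd d),
    m ^ (p + n) * bracket x ^ p * ‖iteratedFDeriv ℝ n φ x‖ ≤ A * (M.seq p * M.seq n)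

/-- The analogue of `DNormLE` for the operator norms of the iterated derivatives. -/
def DOpNormLE (M : WeightSequence) (h A : ℝ) (φ : Rd d → ℂ) : Prop :=
  ∀ (n : ℕ) (x : Rd d), ‖iteratedFDeriv ℝ n φ x‖ ≤ A * (h ^ n * M.seq n)

theorem norm_pderiv_le {n : ℕ} (a : Fin n → Fin d) (φ : Rd d → ℂ) (x : Rd d) :
    ‖pderiv a φ x‖ ≤ ‖iteratedFDeriv ℝ n φ x‖ := by
  refine (ContinuousMultilinearMap.le_opNorm _ _).trans ?_
  simp

/-- Expanding each argument in the standard basis gives d^n words. The base d + 1 is used instead of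
d so that later divisions by it remain valid when d = 0. -/
theorem norm_iteratedFDeriv_le_of_pderiv {n : ℕ} {φ : Rd d → ℂ} {x : Rd d} {C : ℝ}
    (h : ∀ a : Fin n → Fin d, ‖pderiv a φ x‖ ≤ C) (hC : 0 ≤ C) :
    ‖iteratedFDeriv ℝ n φ x‖ ≤ (d + 1 : ℝ) ^ n * C := by
  refine ContinuousMultilinearMap.opNorm_le_bound (by positivity) fun v => ?_
  have hv : v = fun i => ∑ j, v i j • EuclideanSpace.single j (1 : ℝ) := by
    ext i k
    simp [Pi.single_apply]
  have hnorm : ∀ i j, |v i j| ≤ ‖v i‖ := fun i j => PiLp.norm_apply_le (v i) j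
  have : iteratedFDeriv ℝ n φ x v = ∑ a : Fin n → Fin d, (∏ i, v i (a i)) • pderiv a φ x := by
    conv_lhs => rw [hv]
    rw [ContinuousMultilinearMap.map_sum]
    refine Finset.sum_congr rfl fun a _ => ?_
    exact ContinuousMultilinearMap.map_smul_univ _ _ _
  rw [this]
  calc ‖∑ a : Fin n → Fin d, (∏ i, v i (a i)) • pderiv a φ x‖
      ≤ ∑ _a : Fin n → Fin d, (∏ i, ‖v i‖) * C := by
        refine norm_sum_le_of_le _ fun a _ => ?_
        rw [norm_smul, Real.norm_eq_abs, Finset.abs_prod]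
        gcongr
        · exact hnorm _ _
        · exact h a
    _ = (d : ℝ) ^ n * C * ∏ i, ‖v i‖ := by simp; ring
    _ ≤ _ := by gcongr; linarith

theorem SOpNormLE.sNormLE {M : WeightSequence} {m A : ℝ} {φ : Rd d → ℂ}
    (H : SOpNormLE M m A φ) (hm : 0 ≤ m) : SNormLE M m A φ := fun p n a x =>
  (mul_le_mul_of_nonneg_left (norm_pderiv_le a φ x) (by positivity)).trans (H p n x)

theorem SNormLE.nonneg {M : WeightSequence} {m A : ℝ} {φ : Rd d → ℂ} (H : SNormLE M m A φ) :
    0 ≤ A := by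
  have := H 0 0 Fin.elim0 0
  simp only [M.zero, pow_zero, one_mul, mul_one, add_zero] at this
  exact (norm_nonneg _).trans this

theorem SNormLE.sOpNormLE {M : WeightSequence} {m A : ℝ} {φ : Rd d → ℂ}
    (H : SNormLE M m A φ) (hm : 0 < m) : SOpNormLE M (m / (d + 1)) A φ := by
  intro p n x
  have hJ := bracket_pos x
  have hd : (0 : ℝ) < d + 1 := by positivity
  have hA := H.nonneg
  have hp := M.pos p
  have hn := M.pos n
  have h1 := norm_iteratedFDeriv_le_of_pderiv (n := n) (φ := φ) (x := x)
    (C := A * (M.seq p * M.seq n) / (m ^ (p + n) * bracket x ^ p))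
    (fun a => by
      rw [le_div_iff₀ (by positivity), mul_comm]
      exact H p n a x) (by positivity)
  calc (m / (d + 1)) ^ (p + n) * bracket x ^ p * ‖iteratedFDeriv ℝ n φ x‖
      ≤ (m / (d + 1)) ^ (p + n) * bracket x ^ p * ((d + 1 : ℝ) ^ n *
        (A * (M.seq p * M.seq n) / (m ^ (p + n) * bracket x ^ p))) := by gcongr
    _ = A * (M.seq p * M.seq n) / (d + 1 : ℝ) ^ p := by
      rw [div_pow, pow_add (d + 1 : ℝ)]
      field_simp
    _ ≤ _ := div_le_self (by positivity) (one_le_pow₀ (by linarith [Nat.cast_nonneg (α := ℝ) d]))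

theorem DOpNormLE.dNormLE {M : WeightSequence} {h A : ℝ} {φ : Rd d → ℂ}
    (H : DOpNormLE M h A φ) : DNormLE M h A φ := fun n a x =>
  (norm_pderiv_le a φ x).trans (H n x)

theorem DNormLE.dOpNormLE {M : WeightSequence} {h A : ℝ} {φ : Rd d → ℂ}
    (H : DNormLE M h A φ) (hh : 0 ≤ h) : DOpNormLE M ((d + 1) * h) A φ := by
  intro n x
  have hA := H.nonneg
  have hn := M.pos n
  refine (norm_iteratedFDeriv_le_of_pderiv (fun a => H n a x) (by positivity)).trans_eq ?_
  rw [mul_pow]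
  ring

/-- The integral of `⟨x⟩^{-(d+1)}`. -/
def bracketIntegral (d : ℕ) : ℝ := ∫ x : Rd d, (bracket x ^ (d + 1))⁻¹

theorem bracketIntegral_nonneg (d : ℕ) : 0 ≤ bracketIntegral d :=
  integral_nonneg fun x => inv_nonneg.2 (pow_nonneg (bracket_pos x).le _)

theorem norm_le_mul_inv_bracket_pow {E : Type*} [NormedAddCommGroup E] {g : Rd d → E} {C : ℝ}
    (h : ∀ x, bracket x ^ (d + 1) * ‖g x‖ ≤ C) (x : Rd d) :
    ‖g x‖ ≤ C * (bracket x ^ (d + 1))⁻¹ := by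
  rw [← div_eq_mul_inv, le_div_iff₀ (pow_pos (bracket_pos x) _), mul_comm]
  exact h x

theorem integrable_of_bracket_pow_mul_le {E : Type*} [NormedAddCommGroup E] {g : Rd d → E} {C : ℝ}
    (hg : AEStronglyMeasurable g) (h : ∀ x, bracket x ^ (d + 1) * ‖g x‖ ≤ C) : Integrable g :=
  (integrable_inv_bracket_pow.const_mul C).mono' hg
    (Filter.Eventually.of_forall (norm_le_mul_inv_bracket_pow h))

theorem integral_norm_le_of_bracket_pow_mul_le {E : Type*} [NormedAddCommGroup E] {g : Rd d → E}
    {C : ℝ} (h : ∀ x, bracket x ^ (d + 1) * ‖g x‖ ≤ C) :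
    ∫ x, ‖g x‖ ≤ C * bracketIntegral d := by
  rw [bracketIntegral, ← integral_const_mul]
  exact integral_mono_of_nonneg (Filter.Eventually.of_forall fun x => norm_nonneg _)
    (integrable_inv_bracket_pow.const_mul C)
    (Filter.Eventually.of_forall (norm_le_mul_inv_bracket_pow h))

/-! ### Continuity of the Fourier transform on S^*. -/

/-- The bilinear form `(2π)⁻¹ ⟨v, w⟩`. -/
def pairing (d : ℕ) : Rd d →L[ℝ] Rd d →L[ℝ] ℝ := (2 * Real.pi)⁻¹ • innerSL ℝ

theorem pairing_apply (v w : Rd d) : pairing d v w = (2 * Real.pi)⁻¹ * inner ℝ v w := by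
  simp only [pairing, smul_apply, smul_eq_mul]
  rfl

set_option maxSynthPendingDepth 3 in
theorem two_pi_mul_norm_pairing_le : 2 * Real.pi * ‖pairing d‖ ≤ 1 := by
  have hpi := Real.pi_pos
  have h : ‖(innerSL ℝ : Rd d →L[ℝ] Rd d →L[ℝ] ℝ)‖ ≤ 1 :=
    ContinuousLinearMap.opNorm_le_bound _ zero_le_one fun v => by simp
  rw [pairing, norm_smul, Real.norm_of_nonneg (by positivity), ← mul_assoc,
    mul_inv_cancel₀ (by positivity), one_mul]
  exact h

/-- The factor (2π)⁻¹ in the pairing cancels the 2π of the standard character, so the general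
results on derivatives of Fourier integrals apply to the kernel e^{-ix·η}. -/
theorem fourier_eq_fourierIntegral (ψ : Rd d → ℂ) :
    fourier ψ = VectorFourier.fourierIntegral Real.fourierChar volume
      (pairing d).toLinearMap₁₂ ψ := by
  ext x
  have hpi : (Real.pi : ℂ) ≠ 0 := by exact_mod_cast Real.pi_ne_zero
  refine integral_congr_ae (Filter.Eventually.of_forall fun η => ?_)
  simp only [ContinuousLinearMap.toLinearMap₁₂_apply_apply_apply, pairing_apply, Circle.smul_def,
    Real.fourierChar_apply, smul_eq_mul, real_inner_comm x η]
  congr 2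
  push_cast
  field_simp

theorem SOpNormLE.nonneg {M : WeightSequence} {m A : ℝ} {φ : Rd d → ℂ} (H : SOpNormLE M m A φ) :
    0 ≤ A := by
  have := H 0 0 0
  simp only [M.zero, pow_zero, one_mul, mul_one, add_zero] at this
  exact (norm_nonneg _).trans this

theorem SOpNormLE.integrable {M : WeightSequence} {m A : ℝ} {φ : Rd d → ℂ}
    (H : SOpNormLE M m A φ) (hm : 0 < m) (hφ : ContDiff ℝ ∞ φ) (k n : ℕ) :
    Integrable fun v => ‖v‖ ^ k * ‖iteratedFDeriv ℝ n φ v‖ := by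
  have hc : Continuous fun v => ‖v‖ ^ k * ‖iteratedFDeriv ℝ n φ v‖ :=
    (continuous_norm.pow k).mul (hφ.continuous_iteratedFDeriv (mod_cast le_top)).norm
  refine integrable_of_bracket_pow_mul_le hc.aestronglyMeasurable
    (C := A * (M.seq (d + 1 + k) * M.seq n) / m ^ (d + 1 + k + n)) fun x => ?_
  have hJ := bracket_pos x
  rw [le_div_iff₀ (by positivity), Real.norm_of_nonneg (by positivity)]
  refine le_trans ?_ (H (d + 1 + k) n x)
  have := norm_le_bracket x
  calc bracket x ^ (d + 1) * (‖x‖ ^ k * ‖iteratedFDeriv ℝ n φ x‖) * m ^ (d + 1 + k + n)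
      ≤ bracket x ^ (d + 1) * (bracket x ^ k * ‖iteratedFDeriv ℝ n φ x‖) *
        m ^ (d + 1 + k + n) := by gcongr
    _ = _ := by ring

/-- Estimate of a single term of the Leibniz formula. -/
theorem SOpNormLE.leibniz_term_le {M : WeightSequence} {c₀ H m A C : ℝ} {φ : Rd d → ℂ}
    (hφ : SOpNormLE M m A φ) (hm : 0 < m) (hH : 1 ≤ H)
    (hc₀ : 1 ≤ c₀) (hM2 : ∀ p q, q ≤ p → M.seq p ≤ c₀ * H ^ p * (M.seq (p - q) * M.seq q))
    (hC : ∀ k : ℕ, (k.factorial : ℝ) * (m ^ 2) ^ k ≤ C * M.seq k ^ 2) (hC0 : 0 < C)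
    (n p i : ℕ) (hi : i ≤ p) (v : Rd d) :
    (p.choose i * n.descFactorial i : ℝ) * (bracket v ^ (d + 1) *
      (‖v‖ ^ (n - i) * ‖iteratedFDeriv ℝ (p - i) φ v‖)) * m ^ (d + 1 + n + p) ≤
    (2 * H) ^ (n + p) * (C * c₀ * H ^ (d + 1) * M.seq (d + 1) * A * (M.seq n * M.seq p)) := by
  have hA := hφ.nonneg
  have hMn := (M.pos n).le
  have hMp := (M.pos p).le
  have hMd := (M.pos (d + 1)).le
  have hH0 : 0 ≤ H := by linarith
  have hc0 : 0 ≤ c₀ := by linarith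
  -- When i > n the falling factorial vanishes; otherwise n = i + a and p = i + b.
  rcases lt_or_ge n i with hn | hn
  · rw [Nat.descFactorial_of_lt hn]
    simp only [Nat.cast_zero, mul_zero, zero_mul]
    positivity
  obtain ⟨a, rfl⟩ := Nat.exists_eq_add_of_le hn
  obtain ⟨b, rfl⟩ := Nat.exists_eq_add_of_le hi
  rw [Nat.add_sub_cancel_left, Nat.add_sub_cancel_left]
  have hJ := bracket_pos v
  have hMa := (M.pos a).le
  have hMb := (M.pos b).le
  have hMi := (M.pos i).le
  have e1 := hφ (d + 1 + a) b v
  have e2 : M.seq (d + 1 + a) ≤ c₀ * H ^ (d + 1 + a) * (M.seq a * M.seq (d + 1)) := by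
    simpa using hM2 (d + 1 + a) (d + 1) (by omega)
  have e3 := hC i
  have e4 : ((i + b).choose i : ℝ) ≤ 2 ^ (i + b) := by
    exact_mod_cast Nat.choose_le_two_pow (i + b) i
  have e5 : ((i + a).choose i : ℝ) ≤ 2 ^ (i + a) := by
    exact_mod_cast Nat.choose_le_two_pow (i + a) i
  have e6 := M.seq_mul_le i a
  have e7 := M.seq_mul_le i b
  have e8 := norm_le_bracket v
  set D := ‖iteratedFDeriv ℝ b φ v‖ with hD
  have hD0 : 0 ≤ D := norm_nonneg _
  rw [Nat.descFactorial_eq_factorial_mul_choose]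
  push_cast
  calc ((i + b).choose i * (i.factorial * (i + a).choose i) : ℝ) *
        (bracket v ^ (d + 1) * (‖v‖ ^ a * D)) * m ^ (d + 1 + (i + a) + (i + b))
      ≤ (2 ^ (i + b) * (i.factorial * 2 ^ (i + a)) : ℝ) *
        (bracket v ^ (d + 1) * (bracket v ^ a * D)) * m ^ (d + 1 + (i + a) + (i + b)) := by
        gcongr
    -- The powers of m are divided: (m²)^i goes with i!, and the rest is exactly the weight in the
    -- norm bound for ⟨v⟩^{d+1+a} D^b φ.
    _ = 2 ^ (i + a + (i + b)) * (i.factorial * (m ^ 2) ^ i) *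
        (m ^ (d + 1 + a + b) * bracket v ^ (d + 1 + a) * D) := by ring
    _ ≤ 2 ^ (i + a + (i + b)) * (C * M.seq i ^ 2) *
        (A * (c₀ * H ^ (d + 1 + a) * (M.seq a * M.seq (d + 1)) * M.seq b)) := by
        have e9 : A * (M.seq (d + 1 + a) * M.seq b) ≤
            A * (c₀ * H ^ (d + 1 + a) * (M.seq a * M.seq (d + 1)) * M.seq b) := by gcongr
        exact mul_le_mul (mul_le_mul_of_nonneg_left e3 (by positivity)) (e1.trans e9)
          (by positivity) (by positivity)
    _ = 2 ^ (i + a + (i + b)) * H ^ a * (C * c₀ * H ^ (d + 1) * M.seq (d + 1) * A *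
        ((M.seq i * M.seq a) * (M.seq i * M.seq b))) := by ring
    _ ≤ 2 ^ (i + a + (i + b)) * H ^ (i + a + (i + b)) *
        (C * c₀ * H ^ (d + 1) * M.seq (d + 1) * A *
        (M.seq (i + a) * M.seq (i + b))) := by
        gcongr
        omega
    _ = _ := by rw [mul_pow 2 H]

theorem SOpNormLE.bracket_pow_mul_norm_iteratedFDeriv_fourierPowSMulRight_le
    {M : WeightSequence} {c₀ H m A C : ℝ} {φ : Rd d → ℂ}
    (hφ : SOpNormLE M m A φ) (hs : ContDiff ℝ ∞ φ) (hm : 0 < m) (hH : 1 ≤ H)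
    (hc₀ : 1 ≤ c₀) (hM2 : ∀ p q, q ≤ p → M.seq p ≤ c₀ * H ^ p * (M.seq (p - q) * M.seq q))
    (hC : ∀ k : ℕ, (k.factorial : ℝ) * (m ^ 2) ^ k ≤ C * M.seq k ^ 2) (hC0 : 0 < C)
    (n p : ℕ) (v : Rd d) :
    bracket v ^ (d + 1) * ‖iteratedFDeriv ℝ p
      (fun v => VectorFourier.fourierPowSMulRight (pairing d) φ v n) v‖ ≤
    C * c₀ * H ^ (d + 1) * M.seq (d + 1) / m ^ (d + 1) * A *
      ((4 * H / m) ^ (n + p) * (M.seq n * M.seq p)) := by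
  have hA := hφ.nonneg
  have hMn := (M.pos n).le
  have hMp := (M.pos p).le
  have hMd := (M.pos (d + 1)).le
  have hH0 : 0 ≤ H := by linarith
  have hc0 : 0 ≤ c₀ := by linarith
  have hJ := bracket_pos v
  have h1 := VectorFourier.norm_iteratedFDeriv_fourierPowSMulRight_le_sum (pairing d) hs n
    (k := p) (mod_cast le_top) v
  have h2 : (2 * Real.pi * ‖pairing d‖) ^ n ≤ 1 :=
    pow_le_one₀ (by positivity) two_pi_mul_norm_pairing_le
  have h3 : ‖iteratedFDeriv ℝ p
      (fun v => VectorFourier.fourierPowSMulRight (pairing d) φ v n) v‖ ≤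
      ∑ i ∈ Finset.range (p + 1), (p.choose i * n.descFactorial i : ℝ) *
        (‖v‖ ^ (n - i) * ‖iteratedFDeriv ℝ (p - i) φ v‖) :=
    h1.trans (mul_le_of_le_one_left (Finset.sum_nonneg fun i _ => by positivity) h2)
  have h4 : bracket v ^ (d + 1) * (∑ i ∈ Finset.range (p + 1),
      (p.choose i * n.descFactorial i : ℝ) *
        (‖v‖ ^ (n - i) * ‖iteratedFDeriv ℝ (p - i) φ v‖)) * m ^ (d + 1 + n + p) ≤
      (p + 1) * ((2 * H) ^ (n + p) *
        (C * c₀ * H ^ (d + 1) * M.seq (d + 1) * A * (M.seq n * M.seq p))) := by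
    rw [Finset.mul_sum, Finset.sum_mul]
    refine (Finset.sum_le_card_nsmul _ _ ((2 * H) ^ (n + p) *
        (C * c₀ * H ^ (d + 1) * M.seq (d + 1) * A * (M.seq n * M.seq p)))
        fun i hi => ?_).trans_eq (by simp)
    refine (le_of_eq ?_).trans (hφ.leibniz_term_le hm hH hc₀ hM2 hC hC0 n p i
      (Nat.lt_succ_iff.1 (Finset.mem_range.1 hi)) v)
    ring
  -- The p + 1 Leibniz terms cost a factor 2^{n+p}, which turns 2H into the 4H of the conclusion.
  have h5 : (p + 1 : ℝ) ≤ 2 ^ (n + p) := by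
    have : p + 1 ≤ 2 ^ (n + p) :=
      (Nat.lt_two_pow_self (n := p)).trans_le (Nat.pow_le_pow_right (by norm_num) (by omega))
    exact_mod_cast this
  have hpos : 0 < m ^ (d + 1 + n + p) := by positivity
  refine le_of_mul_le_mul_right ?_ hpos
  calc _ ≤ _ := mul_le_mul_of_nonneg_right (mul_le_mul_of_nonneg_left h3 (by positivity)) hpos.le
    _ ≤ _ := h4
    _ ≤ 2 ^ (n + p) * ((2 * H) ^ (n + p) *
        (C * c₀ * H ^ (d + 1) * M.seq (d + 1) * A * (M.seq n * M.seq p))) := by gcongr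
    _ = 4 ^ (n + p) * H ^ (n + p) *
        (C * c₀ * H ^ (d + 1) * M.seq (d + 1) * A * (M.seq n * M.seq p)) := by
      rw [mul_pow, show (4 : ℝ) = 2 * 2 by norm_num, mul_pow]; ring
    _ = _ := by
      rw [div_pow, mul_pow, show m ^ (d + 1 + n + p) = m ^ (d + 1) * m ^ (n + p) by ring]
      field_simp

/-- Up to constants of modulus one and the normalised pairing, w^p D^n(Fφ) is the Fourier transform
of D^p(v^n φ), hence bounded by an L¹ norm; the weight ⟨v⟩^{d+1} makes that norm finite. -/
theorem SOpNormLE.norm_pow_mul_norm_iteratedFDeriv_fourier_le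
    {M : WeightSequence} {c₀ H m A C : ℝ} {φ : Rd d → ℂ}
    (hφ : SOpNormLE M m A φ) (hs : ContDiff ℝ ∞ φ) (hm : 0 < m) (hH : 1 ≤ H)
    (hc₀ : 1 ≤ c₀) (hM2 : ∀ p q, q ≤ p → M.seq p ≤ c₀ * H ^ p * (M.seq (p - q) * M.seq q))
    (hC : ∀ k : ℕ, (k.factorial : ℝ) * (m ^ 2) ^ k ≤ C * M.seq k ^ 2) (hC0 : 0 < C)
    (n p : ℕ) (w : Rd d) :
    ‖w‖ ^ p * ‖iteratedFDeriv ℝ n (fourier φ) w‖ ≤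
    C * c₀ * H ^ (d + 1) * M.seq (d + 1) / m ^ (d + 1) * A *
      ((4 * H / m) ^ (n + p) * (M.seq n * M.seq p)) * bracketIntegral d := by
  have hpi := Real.pi_pos
  have h1 := VectorFourier.fourierPowSMulRight_iteratedFDeriv_fourierIntegral (pairing d)
    (μ := volume) (K := ⊤) (N := ⊤) hs (fun k n _ _ => hφ.integrable hm hs k n) (k := n) (n := p)
    le_top le_top (w := w)
  rw [← fourier_eq_fourierIntegral] at h1
  have h2 : ‖VectorFourier.fourierPowSMulRight (-(pairing d).flip)
      (iteratedFDeriv ℝ n (fourier φ)) w p‖ ≤ C * c₀ * H ^ (d + 1) * M.seq (d + 1) / m ^ (d + 1) *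
      A * ((4 * H / m) ^ (n + p) * (M.seq n * M.seq p)) * bracketIntegral d := by
    rw [h1]
    exact (VectorFourier.norm_fourierIntegral_le_integral_norm _ _ _ _ _).trans
      (integral_norm_le_of_bracket_pow_mul_le fun v =>
        hφ.bracket_pow_mul_norm_iteratedFDeriv_fourierPowSMulRight_le hs hm hH hc₀ hM2 hC hC0 n p v)
  refine le_trans ?_ h2
  rcases eq_or_ne w 0 with rfl | hw
  · rcases Nat.eq_zero_or_pos p with rfl | hp
    · have h3 := ContinuousMultilinearMap.le_opNorm (VectorFourier.fourierPowSMulRight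
        (-(pairing d).flip) (iteratedFDeriv ℝ n (fourier φ)) 0 0) Fin.elim0
      simpa using h3
    · simp [hp.ne']
  have hw' : 0 < ‖w‖ := norm_pos_iff.2 hw
  -- Evaluating the multilinear map at (w, …, w) produces ‖w‖^{2p} on one side and ‖w‖^p on the
  -- other. This is why w = 0 is treated apart.
  have h3 := ContinuousMultilinearMap.le_opNorm (VectorFourier.fourierPowSMulRight
    (-(pairing d).flip) (iteratedFDeriv ℝ n (fourier φ)) w p) (fun _ => w)
  rw [VectorFourier.fourierPowSMulRight_apply] at h3
  have h4 : ‖(-(2 * (Real.pi : ℂ) * Complex.I)) ^ p • (∏ _i : Fin p, (-(pairing d).flip) w w) •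
      iteratedFDeriv ℝ n (fourier φ) w‖ =
      ‖w‖ ^ p * ‖iteratedFDeriv ℝ n (fourier φ) w‖ * ‖w‖ ^ p := by
    have e : ‖(-(pairing d).flip) w w‖ = (2 * Real.pi)⁻¹ * ‖w‖ ^ 2 := by
      simp only [neg_apply, norm_neg, ContinuousLinearMap.flip_apply,
        pairing_apply, real_inner_self_eq_norm_sq]
      exact Real.norm_of_nonneg (by positivity)
    rw [norm_smul, norm_smul, norm_pow, norm_neg, norm_mul, norm_mul, Finset.prod_const, norm_pow,
      e]
    simp only [Complex.norm_ofNat, Complex.norm_real, Complex.norm_I, Finset.card_univ,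
      Fintype.card_fin, Real.norm_of_nonneg hpi.le, mul_one, mul_pow, inv_pow]
    field_simp
    ring
  rw [h4] at h3
  simp only [Finset.prod_const, Finset.card_univ, Fintype.card_fin] at h3
  exact le_of_mul_le_mul_right h3 (by positivity)

theorem SOpNormLE.contDiff_fourier {M : WeightSequence} {m A : ℝ} {φ : Rd d → ℂ}
    (hφ : SOpNormLE M m A φ) (hs : ContDiff ℝ ∞ φ) (hm : 0 < m) : ContDiff ℝ ∞ (fourier φ) := by
  rw [fourier_eq_fourierIntegral]
  refine VectorFourier.contDiff_fourierIntegral (N := ⊤) (pairing d) fun k _ => ?_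
  simpa using hφ.integrable hm hs k 0

theorem exists_sOpNormLE_fourier (M : WeightSequence) (d : ℕ) :
    ∃ c : ℝ, 0 < c ∧ ∀ m, 0 < m → ∃ C, 0 ≤ C ∧ ∀ (φ : Rd d → ℂ) (A : ℝ), ContDiff ℝ ∞ φ →
      SOpNormLE M m A φ → SOpNormLE M (c * m) (C * A) (fourier φ) := by
  obtain ⟨c₀, H, hc₀, hH, hM2⟩ := M.m2
  have hH0 : 0 < H := by linarith
  have hc0 : 0 < c₀ := by linarith
  -- The loss 8H is 4H from the preceding estimate times 2 from ⟨x⟩ ≤ 2|x| for |x| ≥ 1.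
  refine ⟨1 / (8 * H), by positivity, fun m hm => ?_⟩
  obtain ⟨C₁, hC₁, h₁⟩ := M.exists_factorial_mul_pow_le (m ^ 2) (by positivity)
  obtain ⟨C₂, hC₂, h₂⟩ := M.exists_pow_le (m / (4 * H)) (by positivity)
  set K := C₁ * c₀ * H ^ (d + 1) * M.seq (d + 1) / m ^ (d + 1) * bracketIntegral d with hK
  have hK0 : 0 ≤ K := by
    have := (M.pos (d + 1)).le
    have := bracketIntegral_nonneg d
    positivity
  refine ⟨K * (1 + C₂), by positivity, fun φ A hs hφ p n x => ?_⟩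
  have hA := hφ.nonneg
  have hMn := M.pos n
  have hMp := M.pos p
  have hJ := bracket_pos x
  have key : ∀ p, ‖x‖ ^ p * ‖iteratedFDeriv ℝ n (fourier φ) x‖ ≤
      K * A * ((4 * H / m) ^ (n + p) * (M.seq n * M.seq p)) := fun p =>
    (hφ.norm_pow_mul_norm_iteratedFDeriv_fourier_le hs hm hH hc₀ hM2 h₁ hC₁ n p x).trans_eq
      (by rw [hK]; ring)
  set D := ‖iteratedFDeriv ℝ n (fourier φ) x‖ with hD
  have hD0 : 0 ≤ D := norm_nonneg _
  suffices hb : bracket x ^ p * D ≤ 2 ^ p * (K * (1 + C₂) * A *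
      ((4 * H / m) ^ (n + p) * (M.seq n * M.seq p))) by
    calc (1 / (8 * H) * m) ^ (p + n) * bracket x ^ p * D
        ≤ (1 / (8 * H) * m) ^ (p + n) * (2 ^ p * (K * (1 + C₂) * A *
          ((4 * H / m) ^ (n + p) * (M.seq n * M.seq p)))) := by
          rw [mul_assoc]; gcongr
      _ = ((1 / (8 * H) * m) * (4 * H / m)) ^ (p + n) * 2 ^ p *
          (K * (1 + C₂) * A * (M.seq p * M.seq n)) := by
          rw [mul_pow (1 / (8 * H) * m), add_comm n p]
          ring
      _ = (1 / 2) ^ n * (K * (1 + C₂) * A * (M.seq p * M.seq n)) := by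
          rw [show (1 / (8 * H) * m) * (4 * H / m) = 1 / 2 by field_simp; norm_num, pow_add,
            mul_right_comm ((1 / 2 : ℝ) ^ p), ← mul_pow]
          norm_num
      _ ≤ _ := mul_le_of_le_one_left (by positivity) (pow_le_one₀ (by norm_num) (by norm_num))
  -- Near the origin |x|^p does not control ⟨x⟩^p. There ⟨x⟩ ≤ 2, and the estimate with p = 0
  -- suffices because (m/(4H))^p ≤ C₂ M_p.
  rcases le_total ‖x‖ 1 with hx | hx
  · have hb : bracket x ≤ 2 := (bracket_le_of_norm_le hx).trans (by norm_num)
    have h3 : 1 ≤ C₂ * ((4 * H / m) ^ p * M.seq p) := by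
      have := mul_le_mul_of_nonneg_left (h₂ p) (show 0 ≤ (4 * H / m) ^ p by positivity)
      rw [← mul_pow, show 4 * H / m * (m / (4 * H)) = 1 by field_simp, one_pow] at this
      linarith
    have h4 := key 0
    simp only [pow_zero, one_mul, add_zero, M.zero, mul_one] at h4
    calc bracket x ^ p * D ≤ 2 ^ p * (K * A * ((4 * H / m) ^ n * M.seq n)) := by gcongr
      _ ≤ 2 ^ p * (K * A * ((4 * H / m) ^ n * M.seq n) *
          (C₂ * ((4 * H / m) ^ p * M.seq p))) := by
          exact mul_le_mul_of_nonneg_left (le_mul_of_one_le_right (by positivity) h3)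
            (by positivity)
      _ = 2 ^ p * (K * C₂ * A * ((4 * H / m) ^ (n + p) * (M.seq n * M.seq p))) := by ring
      _ ≤ _ := by gcongr; linarith
  · calc bracket x ^ p * D ≤ (2 * ‖x‖) ^ p * D := by
          gcongr
          exact bracket_le_two_mul_norm hx
      _ = 2 ^ p * (‖x‖ ^ p * D) := by ring
      _ ≤ 2 ^ p * (K * A * ((4 * H / m) ^ (n + p) * (M.seq n * M.seq p))) := by
          exact mul_le_mul_of_nonneg_left (key p) (by positivity)
      _ = 2 ^ p * (K * 1 * A * ((4 * H / m) ^ (n + p) * (M.seq n * M.seq p))) := by ring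
      _ ≤ _ := by gcongr; linarith

/-! ### The inclusion of D^* in S^*, and multiplication by exponentials. -/

theorem exists_sOpNormLE_of_dOpNormLE (M : WeightSequence) (d : ℕ) (R : ℝ) (hR : 0 ≤ R) {m h : ℝ}
    (hm : 0 < m) (hh : 0 < h) (hmh : m * h ≤ 1) :
    ∃ C, 0 ≤ C ∧ ∀ (φ : Rd d → ℂ) (A : ℝ), 0 ≤ A → tsupport φ ⊆ Metric.closedBall 0 R →
      DOpNormLE M h A φ → SOpNormLE M m (C * A) φ := by
  obtain ⟨C, hC, hp⟩ := M.exists_pow_le (m * (1 + R)) (by positivity)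
  refine ⟨C, hC.le, fun φ A hA hs hφ p n x => ?_⟩
  have hMp := M.pos p
  have hMn := M.pos n
  have hJ := bracket_pos x
  by_cases hx : x ∈ tsupport φ
  · have hb : bracket x ≤ 1 + R := bracket_le_of_norm_le (by simpa using hs hx)
    calc m ^ (p + n) * bracket x ^ p * ‖iteratedFDeriv ℝ n φ x‖
        ≤ m ^ (p + n) * (1 + R) ^ p * (A * (h ^ n * M.seq n)) := by
          gcongr
          exact hφ n x
      _ = (m * (1 + R)) ^ p * (m * h) ^ n * (A * M.seq n) := by
          rw [mul_pow, mul_pow]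
          ring
      _ ≤ C * M.seq p * 1 * (A * M.seq n) := by
          gcongr
          · exact hp p
          · exact pow_le_one₀ (by positivity) hmh
      _ = _ := by ring
  · have h0 : iteratedFDeriv ℝ n φ x = 0 :=
      Function.notMem_support.1 fun h => hx (support_iteratedFDeriv_subset n h)
    rw [h0, norm_zero, mul_zero]
    positivity

theorem norm_iteratedFDeriv_exp_inner_le (ξ x : Rd d) (n : ℕ) :
    ‖iteratedFDeriv ℝ n (fun x : Rd d => Real.exp (-inner ℝ x ξ)) x‖ ≤
      Real.exp (‖x‖ * ‖ξ‖) * ‖ξ‖ ^ n := by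
  have h : (fun x : Rd d => Real.exp (-inner ℝ x ξ)) = Real.exp ∘ (-(innerSL ℝ ξ)) := by
    ext x
    simp [real_inner_comm]
  rw [h, ContinuousLinearMap.iteratedFDeriv_comp_right _ Real.contDiff_exp (n := n) _ le_rfl]
  refine (ContinuousMultilinearMap.norm_compContinuousLinearMap_le _ _).trans ?_
  rw [norm_iteratedFDeriv_eq_norm_iteratedDeriv, iteratedDeriv_eq_iterate, Real.iter_deriv_exp,
    Finset.prod_const, Finset.card_univ, Fintype.card_fin, norm_neg, innerSL_apply_norm,
    Real.norm_eq_abs, Real.abs_exp]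
  gcongr
  simp only [neg_apply, innerSL_apply_apply]
  refine (neg_le_abs _).trans ((abs_real_inner_le_norm ξ x).trans_eq (mul_comm _ _))

theorem expMul_eq_smul (ξ : Rd d) (φ : Rd d → ℂ) :
    expMul ξ φ = fun x => Real.exp (-inner ℝ x ξ) • φ x := by
  ext x
  simp [expMul]

theorem contDiff_exp_inner (ξ : Rd d) :
    ContDiff ℝ ∞ fun x : Rd d => Real.exp (-inner ℝ x ξ) :=
  Real.contDiff_exp.comp (contDiff_id.inner ℝ contDiff_const).neg

theorem contDiff_expMul (ξ : Rd d) {φ : Rd d → ℂ} (hφ : ContDiff ℝ ∞ φ) :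
    ContDiff ℝ ∞ (expMul ξ φ) := by
  rw [expMul_eq_smul]
  exact (contDiff_exp_inner ξ).smul hφ

theorem tsupport_expMul_subset (ξ : Rd d) (φ : Rd d → ℂ) :
    tsupport (expMul ξ φ) ⊆ tsupport φ :=
  tsupport_mul_subset_right

/-- On the support, the i-th derivative of the exponential is at most e^{RR'} R'^i ≤ C h^i M_i.
Supermultiplicativity recombines the weights, and the binomial sum 2^n accounts for 2h. The constant
is uniform over |ξ| ≤ R', as the contour shift requires. -/
theorem exists_dOpNormLE_expMul (M : WeightSequence) (d : ℕ) (R R' : ℝ) (hR : 0 ≤ R) (hR' : 0 ≤ R')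
    {h : ℝ} (hh : 0 < h) :
    ∃ C, 0 ≤ C ∧ ∀ (φ : Rd d → ℂ) (A : ℝ) (ξ : Rd d), 0 ≤ A → ContDiff ℝ ∞ φ →
      tsupport φ ⊆ Metric.closedBall 0 R → ‖ξ‖ ≤ R' → DOpNormLE M h A φ →
      DOpNormLE M (2 * h) (C * A) (expMul ξ φ) := by
  obtain ⟨C, hC, hp⟩ := M.exists_pow_le (R' / h) (by positivity)
  refine ⟨Real.exp (R * R') * C, by positivity, fun φ A ξ hA hsm hs hξ hφ n x => ?_⟩
  have hMn := M.pos n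
  by_cases hx : x ∈ tsupport φ
  · have hxR : ‖x‖ ≤ R := by simpa using hs hx
    rw [expMul_eq_smul]
    refine (norm_iteratedFDeriv_smul_le (contDiff_exp_inner ξ) hsm x (n := n)
      (mod_cast le_top)).trans ?_
    have key : ∀ i ∈ Finset.range (n + 1), (n.choose i : ℝ) *
        ‖iteratedFDeriv ℝ i (fun x : Rd d => Real.exp (-inner ℝ x ξ)) x‖ *
        ‖iteratedFDeriv ℝ (n - i) φ x‖ ≤
        n.choose i * (Real.exp (R * R') * C * A * (h ^ n * M.seq n)) := by
      intro i hi
      have hi' : i ≤ n := Nat.lt_succ_iff.1 (Finset.mem_range.1 hi)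
      have h1 : ‖iteratedFDeriv ℝ i (fun x : Rd d => Real.exp (-inner ℝ x ξ)) x‖ ≤
          Real.exp (R * R') * (C * M.seq i * h ^ i) := by
        refine (norm_iteratedFDeriv_exp_inner_le ξ x i).trans ?_
        have h2 := hp i
        rw [div_pow, div_le_iff₀ (by positivity)] at h2
        have h3 : ‖ξ‖ ^ i ≤ C * M.seq i * h ^ i := (by gcongr : ‖ξ‖ ^ i ≤ R' ^ i).trans h2
        gcongr
      have h4 := M.seq_mul_seq_sub_le hi'
      have h5 := M.pos i
      calc (n.choose i : ℝ) *
            ‖iteratedFDeriv ℝ i (fun x : Rd d => Real.exp (-inner ℝ x ξ)) x‖ *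
            ‖iteratedFDeriv ℝ (n - i) φ x‖
          ≤ n.choose i * (Real.exp (R * R') * (C * M.seq i * h ^ i)) *
            (A * (h ^ (n - i) * M.seq (n - i))) := by
            gcongr
            exact hφ (n - i) x
        _ = n.choose i * (Real.exp (R * R') * C * A * (h ^ i * h ^ (n - i) *
            (M.seq i * M.seq (n - i)))) := by ring
        _ ≤ n.choose i * (Real.exp (R * R') * C * A * (h ^ i * h ^ (n - i) * M.seq n)) := by
            gcongr
        _ = _ := by rw [← pow_add, Nat.add_sub_cancel' hi']
    refine (Finset.sum_le_sum key).trans_eq ?_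
    rw [← Finset.sum_mul]
    have : ∑ i ∈ Finset.range (n + 1), (n.choose i : ℝ) = 2 ^ n := by
      exact_mod_cast Nat.sum_range_choose n
    rw [this, mul_pow]
    ring
  · have h0 : iteratedFDeriv ℝ n (expMul ξ φ) x = 0 :=
      Function.notMem_support.1 fun h =>
        hx (tsupport_expMul_subset ξ φ (support_iteratedFDeriv_subset n h))
    rw [h0, norm_zero]
    positivity

theorem hasCompactSupport_exists_closedBall {φ : Rd d → ℂ} (h : HasCompactSupport φ) :
    ∃ R, 0 ≤ R ∧ tsupport φ ⊆ Metric.closedBall 0 R := by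
  obtain ⟨R, hR⟩ := h.isCompact.isBounded.subset_closedBall 0
  exact ⟨max R 0, le_max_right _ _, hR.trans (Metric.closedBall_subset_closedBall (le_max_left _ _))⟩

theorem expMul_mem_DSpace {M : WeightSequence} {t : Kind} (ξ : Rd d) {φ : Rd d → ℂ}
    (hφ : φ ∈ DSpace M t d) : expMul ξ φ ∈ DSpace M t d := by
  obtain ⟨h1, h2, h3⟩ := hφ
  obtain ⟨R, hR, hs⟩ := hasCompactSupport_exists_closedBall h2
  have key : ∀ h, 0 < h → (∃ A, DNormLE M h A φ) →
      ∃ A, DNormLE M (2 * ((d + 1) * h)) A (expMul ξ φ) := by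
    rintro h hh ⟨A, hA⟩
    obtain ⟨C, -, hC⟩ := exists_dOpNormLE_expMul M d R ‖ξ‖ hR (norm_nonneg _)
      (h := (d + 1) * h) (by positivity)
    exact ⟨_, (hC φ A ξ hA.nonneg h1 hs le_rfl (hA.dOpNormLE hh.le)).dNormLE⟩
  refine ⟨contDiff_expMul ξ h1, h2.mono' ((subset_tsupport _).trans (tsupport_expMul_subset ξ φ)), ?_⟩
  cases t with
  | beurling =>
    intro h hh
    have := key (h / (2 * (d + 1))) (by positivity) (h3 _ (by positivity))
    rwa [show 2 * ((d + 1) * (h / (2 * (d + 1)))) = h by field_simp] at this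
  | roumieu =>
    obtain ⟨h, hh, hA⟩ := h3
    exact ⟨_, by positivity, key h hh hA⟩

theorem mem_SSpace_of_mem_DSpace {M : WeightSequence} {t : Kind} {φ : Rd d → ℂ}
    (hφ : φ ∈ DSpace M t d) : φ ∈ SSpace M t d := by
  obtain ⟨h1, h2, h3⟩ := hφ
  obtain ⟨R, hR, hs⟩ := hasCompactSupport_exists_closedBall h2
  have key : ∀ h, 0 < h → (∃ A, DNormLE M h A φ) →
      ∃ A, SNormLE M (1 / ((d + 1) * h)) A φ := by
    rintro h hh ⟨A, hA⟩
    obtain ⟨C, -, hC⟩ := exists_sOpNormLE_of_dOpNormLE M d R hR (m := 1 / ((d + 1) * h))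
      (h := (d + 1) * h) (by positivity) (by positivity) (le_of_eq (by field_simp))
    exact ⟨_, (hC φ A hA.nonneg hs (hA.dOpNormLE hh.le)).sNormLE (by positivity)⟩
  refine ⟨h1, ?_⟩
  cases t with
  | beurling =>
    intro m hm
    have := key (1 / ((d + 1) * m)) (by positivity) (h3 _ (by positivity))
    rwa [show 1 / ((d + 1) * (1 / ((d + 1) * m))) = m by field_simp] at this
  | roumieu =>
    obtain ⟨h, hh, hA⟩ := h3
    exact ⟨_, by positivity, key h hh hA⟩

/-! ### Stability of S^* under the Fourier transform, and inversion. -/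

theorem exists_sNormLE_fourier (M : WeightSequence) (d : ℕ) :
    ∃ c : ℝ, 0 < c ∧ ∀ m, 0 < m → ∃ C, 0 ≤ C ∧ ∀ (φ : Rd d → ℂ) (A : ℝ), ContDiff ℝ ∞ φ →
      SNormLE M m A φ → SNormLE M (c * m) (C * A) (fourier φ) := by
  obtain ⟨c, hc, h⟩ := exists_sOpNormLE_fourier M d
  refine ⟨c / (d + 1), by positivity, fun m hm => ?_⟩
  obtain ⟨C, hC, hφ⟩ := h (m / (d + 1)) (by positivity)
  refine ⟨C, hC, fun φ A hs hA => ?_⟩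
  have := (hφ φ A hs (hA.sOpNormLE hm)).sNormLE (by positivity)
  rwa [show c * (m / (d + 1)) = c / (d + 1) * m by ring] at this

theorem fourier_mem_SSpace {M : WeightSequence} {t : Kind} {φ : Rd d → ℂ}
    (hφ : φ ∈ SSpace M t d) : fourier φ ∈ SSpace M t d := by
  obtain ⟨h1, h3⟩ := hφ
  obtain ⟨c, hc, h⟩ := exists_sNormLE_fourier M d
  cases t with
  | beurling =>
    obtain ⟨A, hA⟩ := h3 1 one_pos
    refine ⟨(hA.sOpNormLE one_pos).contDiff_fourier h1 (by positivity), fun m hm => ?_⟩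
    obtain ⟨C, -, hC⟩ := h (m / c) (by positivity)
    obtain ⟨A, hA⟩ := h3 (m / c) (by positivity)
    have := hC φ A h1 hA
    rw [mul_div_cancel₀ _ hc.ne'] at this
    exact ⟨_, this⟩
  | roumieu =>
    obtain ⟨m, hm, A, hA⟩ := h3
    obtain ⟨C, -, hC⟩ := h m hm
    exact ⟨(hA.sOpNormLE hm).contDiff_fourier h1 (by positivity), c * m, by positivity, _,
      hC φ A h1 hA⟩

theorem SFinite.exists_sNormLE {M : WeightSequence} {t : Kind} {φ : Rd d → ℂ}
    (h : SFinite M t φ) : ∃ m, 0 < m ∧ ∃ A, SNormLE M m A φ := by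
  cases t with
  | beurling => exact ⟨1, one_pos, h 1 one_pos⟩
  | roumieu => exact h

theorem integrable_of_mem_SSpace {M : WeightSequence} {t : Kind} {φ : Rd d → ℂ}
    (hφ : φ ∈ SSpace M t d) : Integrable φ := by
  obtain ⟨h1, h3⟩ := hφ
  obtain ⟨m, hm, A, hA⟩ := h3.exists_sNormLE
  have := (hA.sOpNormLE hm).integrable (by positivity) h1 0 0
  refine (integrable_norm_iff h1.continuous.aestronglyMeasurable).1 ?_
  simpa using this

/-- The inverse Fourier transform `(2π)^{-d} ∫ e^{i x·η} φ(x) dx`. -/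
def invFourier (φ : Rd d → ℂ) (η : Rd d) : ℂ :=
  ((2 * Real.pi : ℂ) ^ d)⁻¹ * fourier φ (-η)

theorem fourier_eq_real_fourier (ψ : Rd d → ℂ) (x : Rd d) :
    fourier ψ x = FourierTransform.fourier ψ ((2 * Real.pi)⁻¹ • x) := by
  have hpi : (Real.pi : ℂ) ≠ 0 := by exact_mod_cast Real.pi_ne_zero
  rw [Real.fourier_eq']
  refine integral_congr_ae (Filter.Eventually.of_forall fun η => ?_)
  simp only [smul_eq_mul, inner_smul_right, real_inner_comm x η]
  congr 2
  push_cast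
  field_simp

/-- The inversion formula for the kernel e^{-2πi x·η}, rescaled by x ↦ x/(2π); the Jacobian (2π)^d
cancels the normalisation. -/
theorem invFourier_fourier {ψ : Rd d → ℂ} (hc : Continuous ψ) (hψ : Integrable ψ)
    (hF : Integrable (fourier ψ)) : invFourier (fourier ψ) = ψ := by
  have hpi := Real.pi_pos
  have hF' : Integrable (FourierTransform.fourier ψ) := by
    refine (hF.comp_smul (R := 2 * Real.pi) (by positivity)).congr
      (Filter.Eventually.of_forall fun x => ?_)
    simp only [fourier_eq_real_fourier, smul_smul]
    rw [inv_mul_cancel₀ (by positivity), one_smul]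
  ext η
  conv_rhs => rw [← hc.fourierInv_fourier_eq hψ hF', Real.fourierInv_eq']
  have h := Measure.integral_comp_smul (volume : Measure (Rd d)) (fun v : Rd d =>
    Complex.exp (↑(2 * Real.pi * inner ℝ v η) * Complex.I) • FourierTransform.fourier ψ v)
    (2 * Real.pi)⁻¹
  have h2 : fourier (fourier ψ) (-η) = ∫ x : Rd d,
      Complex.exp (↑(2 * Real.pi * inner ℝ ((2 * Real.pi)⁻¹ • x) η) * Complex.I) •
        FourierTransform.fourier ψ ((2 * Real.pi)⁻¹ • x) := by
    refine integral_congr_ae (Filter.Eventually.of_forall fun x => ?_)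
    simp only [smul_eq_mul, inner_smul_left, inner_neg_left, ← fourier_eq_real_fourier,
      real_inner_comm η x]
    congr 2
    have hpi' : (Real.pi : ℂ) ≠ 0 := by exact_mod_cast hpi.ne'
    push_cast
    simp
    field_simp
  rw [invFourier, h2, h, inv_pow, inv_inv, finrank_euclideanSpace_fin, abs_of_pos (by positivity),
    Complex.real_smul]
  push_cast
  rw [inv_mul_cancel_left₀]
  have hpi' : (Real.pi : ℂ) ≠ 0 := by exact_mod_cast hpi.ne'
  exact pow_ne_zero _ (mul_ne_zero two_ne_zero hpi')

/-! ### Index quantifiers and the bounds behind the continuity of the functionals. -/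

/-- `P` holds for some positive index (Beurling), for every positive index (Roumieu). -/
def ForIndex (t : Kind) (P : ℝ → Prop) : Prop :=
  match t with
  | .beurling => ∃ m : ℝ, 0 < m ∧ P m
  | .roumieu => ∀ m : ℝ, 0 < m → P m

/-- The index h of D^* varies inversely to the index m of S^*. An involution makes every positive
number a value of F, as the universal quantifier demands. -/
theorem ForIndex.map {t : Kind} {P Q : ℝ → Prop} (h : ForIndex t P) (F : ℝ → ℝ)
    (hF : ∀ m, 0 < m → 0 < F m) (hF' : ∀ m, 0 < m → F (F m) = m)
    (hPQ : ∀ m, 0 < m → P m → Q (F m)) : ForIndex t Q := by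
  cases t with
  | beurling =>
    obtain ⟨m, hm, hP⟩ := h
    exact ⟨F m, hF m hm, hPQ m hm hP⟩
  | roumieu =>
    intro m hm
    have := hPQ (F m) (hF m hm) (h _ (hF m hm))
    rwa [hF' m hm] at this

theorem ForIndex.map_mul {t : Kind} {P Q : ℝ → Prop} (h : ForIndex t P) {c : ℝ} (hc : 0 < c)
    (hPQ : ∀ m, 0 < m → P (c * m) → Q m) : ForIndex t Q := by
  cases t with
  | beurling =>
    obtain ⟨m, hm, hP⟩ := h
    refine ⟨m / c, by positivity, hPQ _ (by positivity) ?_⟩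
    rwa [mul_div_cancel₀ _ hc.ne']
  | roumieu => exact fun m hm => hPQ m hm (h _ (by positivity))

/-- The two quantifier patterns are dual: in the Beurling case the property chooses the index and
the function accepts any, in the Roumieu case the roles are exchanged. -/
theorem ForIndex.exists_sNormLE {M : WeightSequence} {t : Kind} {P : ℝ → Prop} (h : ForIndex t P)
    {φ : Rd d → ℂ} (hφ : SFinite M t φ) : ∃ m, 0 < m ∧ P m ∧ ∃ A, SNormLE M m A φ := by
  cases t with
  | beurling =>
    obtain ⟨m, hm, hP⟩ := h
    exact ⟨m, hm, hP, hφ m hm⟩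
  | roumieu =>
    obtain ⟨m, hm, hA⟩ := hφ
    exact ⟨m, hm, h m hm, hA⟩

theorem ForIndex.exists_dNormLE {M : WeightSequence} {t : Kind} {P : ℝ → Prop} (h : ForIndex t P)
    {φ : Rd d → ℂ} (hφ : DFinite M t φ) : ∃ m, 0 < m ∧ P m ∧ ∃ A, DNormLE M m A φ := by
  cases t with
  | beurling =>
    obtain ⟨m, hm, hP⟩ := h
    exact ⟨m, hm, hP, hφ m hm⟩
  | roumieu =>
    obtain ⟨m, hm, hA⟩ := hφ
    exact ⟨m, hm, h m hm, hA⟩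

/-- The growth condition on the compact set `K`. -/
def GrowthOn (M : WeightSequence) (t : Kind) (K : Set (Rd d)) (f : (Fin d → ℂ) → ℂ) : Prop :=
  ForIndex t fun k => ∃ C, 0 ≤ C ∧
    ∀ ξ ∈ K, ∀ η : Rd d, ‖f (cpoint ξ η)‖ ≤ C * Real.exp (M.assoc (k * ‖η‖))

theorem GrowthCondition.growthOn {M : WeightSequence} {t : Kind} {B : Set (Rd d)}
    {f : (Fin d → ℂ) → ℂ} (h : GrowthCondition M t B f) {K : Set (Rd d)} (hK : IsCompact K)
    (hKB : K ⊆ B) : GrowthOn M t K f := by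
  cases t with
  | beurling =>
    obtain ⟨C, k, hC, hk, H⟩ := h K hK hKB
    exact ⟨k, hk, C, hC.le, H⟩
  | roumieu =>
    intro k hk
    obtain ⟨C, hC, H⟩ := h K hK hKB k hk
    exact ⟨C, hC.le, H⟩

theorem pderiv_fin_zero (a : Fin 0 → Fin d) (φ : Rd d → ℂ) (x : Rd d) : pderiv a φ x = φ x :=
  iteratedFDeriv_zero_apply _

/-- The norm is applied with exponent p + d + 1, and (M.2) splits M_{p+d+1} into M_p M_{d+1}. The
factor H^p this costs is the reason for c = 1/H. -/
theorem exists_bracket_pow_mul_exp_assoc_le (M : WeightSequence) (d : ℕ) :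
    ∃ c : ℝ, 0 < c ∧ ∀ m, 0 < m → ∃ C, 0 ≤ C ∧ ∀ (ψ : Rd d → ℂ) (A : ℝ), SNormLE M m A ψ →
      ∀ η, bracket η ^ (d + 1) * (Real.exp (M.assoc (c * m * ‖η‖)) * ‖ψ η‖) ≤ C * A := by
  obtain ⟨c₀, H, hc₀, hH, hM2⟩ := M.m2
  have hH0 : 0 < H := by linarith
  have hc0 : 0 < c₀ := by linarith
  have hMd := M.pos (d + 1)
  refine ⟨1 / H, by positivity, fun m hm => ⟨c₀ * H ^ (d + 1) * M.seq (d + 1) / m ^ (d + 1),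
    by positivity, fun ψ A hψ η => ?_⟩⟩
  have hA := hψ.nonneg
  have hJ := bracket_pos η
  have hJ' := norm_le_bracket η
  rw [mul_left_comm]
  refine M.exp_assoc_mul_le (by positivity) (by positivity) fun p => ?_
  have hMp := M.pos p
  have h1 := hψ (p + (d + 1)) 0 Fin.elim0 η
  rw [pderiv_fin_zero, M.zero, mul_one, add_zero] at h1
  have h2 : M.seq (p + (d + 1)) ≤ c₀ * H ^ (p + (d + 1)) * (M.seq p * M.seq (d + 1)) := by
    simpa using hM2 (p + (d + 1)) (d + 1) (by omega)
  have h3 : m ^ (p + (d + 1)) * bracket η ^ (p + (d + 1)) * ‖ψ η‖ ≤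
      A * (c₀ * H ^ (p + (d + 1)) * (M.seq p * M.seq (d + 1))) :=
    h1.trans (by gcongr)
  have hpos : 0 < H ^ p * m ^ (d + 1) := by positivity
  refine le_of_mul_le_mul_left ?_ hpos
  calc H ^ p * m ^ (d + 1) * ((1 / H * m * ‖η‖) ^ p * (bracket η ^ (d + 1) * ‖ψ η‖))
      ≤ H ^ p * m ^ (d + 1) * ((1 / H * m * bracket η) ^ p * (bracket η ^ (d + 1) * ‖ψ η‖)) := by
        gcongr
    _ = m ^ (p + (d + 1)) * bracket η ^ (p + (d + 1)) * ‖ψ η‖ := by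
        rw [mul_pow, mul_pow, div_pow, one_pow]
        field_simp
        ring
    _ ≤ _ := h3
    _ = _ := by
        field_simp
        ring

theorem exists_bracket_pow_mul_exp_assoc_invFourier_le (M : WeightSequence) (d : ℕ) :
    ∃ c : ℝ, 0 < c ∧ ∀ m, 0 < m → ∃ C, 0 ≤ C ∧ ∀ (φ : Rd d → ℂ) (A : ℝ), ContDiff ℝ ∞ φ →
      SNormLE M m A φ →
      ∀ η, bracket η ^ (d + 1) * (Real.exp (M.assoc (c * m * ‖η‖)) * ‖invFourier φ η‖) ≤
        C * A := by
  obtain ⟨c₁, hc₁, h₁⟩ := exists_bracket_pow_mul_exp_assoc_le M d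
  obtain ⟨c₂, hc₂, h₂⟩ := exists_sNormLE_fourier M d
  refine ⟨c₁ * c₂, by positivity, fun m hm => ?_⟩
  obtain ⟨C₂, hC₂, H₂⟩ := h₂ m hm
  obtain ⟨C₁, hC₁, H₁⟩ := h₁ (c₂ * m) (by positivity)
  refine ⟨‖((2 * Real.pi : ℂ) ^ d)⁻¹‖ * (C₁ * C₂), by positivity, fun φ A hs hφ η => ?_⟩
  have := H₁ _ _ (H₂ φ A hs hφ) (-η)
  rw [norm_neg, ← mul_assoc c₁, show bracket (-η) = bracket η by simp [bracket]] at this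
  rw [invFourier, norm_mul]
  calc _ = ‖((2 * Real.pi : ℂ) ^ d)⁻¹‖ * (bracket η ^ (d + 1) *
        (Real.exp (M.assoc (c₁ * c₂ * m * ‖η‖)) * ‖fourier φ (-η)‖)) := by ring
    _ ≤ ‖((2 * Real.pi : ℂ) ^ d)⁻¹‖ * (C₁ * (C₂ * A)) := by gcongr
    _ = _ := by ring

/-- The pointwise bound that makes the functional `φ ↦ ∫ f(ξ + iη) (F⁻¹ φ)(η) dη` continuous. -/
theorem GrowthOn.sNorm_bound {M : WeightSequence} {t : Kind} {K : Set (Rd d)}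
    {f : (Fin d → ℂ) → ℂ} (h : GrowthOn M t K f) :
    ForIndex t fun m => ∃ C, 0 ≤ C ∧ ∀ ξ ∈ K, ∀ (φ : Rd d → ℂ) (A : ℝ), ContDiff ℝ ∞ φ →
      SNormLE M m A φ → ∀ η, bracket η ^ (d + 1) * ‖f (cpoint ξ η) * invFourier φ η‖ ≤ C * A := by
  obtain ⟨c, hc, H⟩ := exists_bracket_pow_mul_exp_assoc_invFourier_le M d
  refine ForIndex.map_mul h hc fun m hm => ?_
  rintro ⟨C, hC, hf⟩
  obtain ⟨C', hC', H'⟩ := H m hm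
  refine ⟨C * C', by positivity, fun ξ hξ φ A hs hφ η => ?_⟩
  have hJ := bracket_pos η
  rw [norm_mul]
  calc bracket η ^ (d + 1) * (‖f (cpoint ξ η)‖ * ‖invFourier φ η‖)
      ≤ bracket η ^ (d + 1) * (C * Real.exp (M.assoc (c * m * ‖η‖)) * ‖invFourier φ η‖) := by
        gcongr
        exact hf ξ hξ η
    _ = C * (bracket η ^ (d + 1) *
        (Real.exp (M.assoc (c * m * ‖η‖)) * ‖invFourier φ η‖)) := by ring
    _ ≤ C * (C' * A) := mul_le_mul_of_nonneg_left (H' φ A hs hφ η) hC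
    _ = _ := by ring

theorem GrowthOn.dNorm_bound {M : WeightSequence} {t : Kind} {K : Set (Rd d)}
    {f : (Fin d → ℂ) → ℂ} (h : GrowthOn M t K f) {R R' : ℝ} (hR : 0 ≤ R) (hR' : 0 ≤ R')
    (hK : ∀ ξ ∈ K, ‖ξ‖ ≤ R') :
    ForIndex t fun h => ∃ C, 0 ≤ C ∧ ∀ ξ ∈ K, ∀ (φ : Rd d → ℂ) (A : ℝ), ContDiff ℝ ∞ φ →
      tsupport φ ⊆ Metric.closedBall 0 R → DNormLE M h A φ →
      ∀ η, bracket η ^ (d + 1) * ‖f (cpoint ξ η) * invFourier (expMul (-ξ) φ) η‖ ≤ C * A := by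
  refine h.sNorm_bound.map (fun m => 1 / (2 * ((d + 1) * m))) (fun m hm => by positivity)
    (fun m hm => by field_simp) fun m hm => ?_
  rintro ⟨C, hC, H⟩
  set h := 1 / (2 * ((d + 1) * m)) with hh
  have hh0 : 0 < h := by positivity
  obtain ⟨C₁, hC₁, H₁⟩ := exists_dOpNormLE_expMul M d R R' hR hR' (h := (d + 1) * h) (by positivity)
  obtain ⟨C₂, hC₂, H₂⟩ := exists_sOpNormLE_of_dOpNormLE M d R hR (m := m)
    (h := 2 * ((d + 1) * h)) hm (by positivity) (le_of_eq (by rw [hh]; field_simp))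
  refine ⟨C * (C₂ * C₁), by positivity, fun ξ hξ φ A hs hsupp hφ η => ?_⟩
  have h1 := H₁ φ A (-ξ) hφ.nonneg hs hsupp (by simpa using hK ξ hξ) (hφ.dOpNormLE hh0.le)
  have h2 := H₂ _ _ (mul_nonneg hC₁ hφ.nonneg) ((tsupport_expMul_subset _ _).trans hsupp) h1
  refine (H ξ hξ _ _ (contDiff_expMul _ hs) (h2.sNormLE hm.le) η).trans_eq ?_
  ring

/-! ### The functionals T_ξ and S. -/

theorem continuous_cpoint (ξ : Rd d) : Continuous (cpoint ξ) := by
  unfold cpoint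
  fun_prop

theorem continuous_fourier {M : WeightSequence} {t : Kind} {φ : Rd d → ℂ}
    (hφ : φ ∈ SSpace M t d) : Continuous (fourier φ) :=
  (fourier_mem_SSpace hφ).1.continuous

theorem continuous_invFourier {M : WeightSequence} {t : Kind} {φ : Rd d → ℂ}
    (hφ : φ ∈ SSpace M t d) : Continuous (invFourier φ) :=
  continuous_const.mul ((continuous_fourier hφ).comp continuous_neg)

theorem integrable_fourier_kernel_mul {φ : Rd d → ℂ} (hφ : Integrable φ) (x : Rd d) :
    Integrable fun η : Rd d => Complex.exp (-Complex.I * ((inner ℝ x η : ℝ) : ℂ)) * φ η := by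
  refine hφ.bdd_mul (c := 1) (Continuous.aestronglyMeasurable (by fun_prop))
    (Filter.Eventually.of_forall fun η => ?_)
  rw [Complex.norm_exp]
  simp

theorem invFourier_add {φ ψ : Rd d → ℂ} (hφ : Integrable φ) (hψ : Integrable ψ) (η : Rd d) :
    invFourier (φ + ψ) η = invFourier φ η + invFourier ψ η := by
  simp only [invFourier, fourier, Pi.add_apply, mul_add]
  rw [integral_add (integrable_fourier_kernel_mul hφ _) (integrable_fourier_kernel_mul hψ _),
    mul_add]

theorem invFourier_smul (c : ℂ) (φ : Rd d → ℂ) (η : Rd d) :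
    invFourier (c • φ) η = c * invFourier φ η := by
  simp only [invFourier, fourier, Pi.smul_apply, smul_eq_mul, mul_left_comm _ c]
  rw [integral_const_mul]
  ring

theorem GrowthOn.integrable {M : WeightSequence} {t : Kind} {K : Set (Rd d)}
    {f : (Fin d → ℂ) → ℂ} (h : GrowthOn M t K f) {ξ : Rd d} (hξ : ξ ∈ K)
    (hf : Continuous fun η => f (cpoint ξ η)) {φ : Rd d → ℂ} (hφ : φ ∈ SSpace M t d) :
    Integrable fun η => f (cpoint ξ η) * invFourier φ η := by
  obtain ⟨m, hm, ⟨C, -, H⟩, A, hA⟩ := h.sNorm_bound.exists_sNormLE hφ.2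
  exact integrable_of_bracket_pow_mul_le (hf.mul (continuous_invFourier hφ)).aestronglyMeasurable
    (H ξ hξ φ A hφ.1 hA)

/-- The functional `φ ↦ ∫ f(ξ + iη) (F⁻¹ φ)(η) dη` on `S^*`. -/
def fourierFunctional {M : WeightSequence} {t : Kind} {f : (Fin d → ℂ) → ℂ} {ξ : Rd d}
    (h : GrowthOn M t {ξ} f) (hf : Continuous fun η => f (cpoint ξ η)) :
    TemperedUltradistribution M t d where
  toFun :=
    { toFun := fun φ => ∫ η, f (cpoint ξ η) * invFourier φ η
      map_add' := fun φ ψ => by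
        rw [← integral_add (h.integrable rfl hf φ.2) (h.integrable rfl hf ψ.2)]
        congr 1 with η
        rw [Submodule.coe_add, invFourier_add (integrable_of_mem_SSpace φ.2)
          (integrable_of_mem_SSpace ψ.2), mul_add]
      map_smul' := fun c φ => by
        rw [RingHom.id_apply, smul_eq_mul, ← integral_const_mul]
        congr 1 with η
        rw [Submodule.coe_smul, invFourier_smul, mul_left_comm] }
  cont := by
    have key : ForIndex t fun m => ∃ C, ∀ φ : SSpace M t d, ∀ A, SNormLE M m A (φ : Rd d → ℂ) →
        ‖∫ η, f (cpoint ξ η) * invFourier φ η‖ ≤ C * A := by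
      refine h.sNorm_bound.map_mul one_pos fun m hm => ?_
      rw [one_mul]
      rintro ⟨C, -, H⟩
      refine ⟨C * bracketIntegral d, fun φ A hA => (norm_integral_le_integral_norm _).trans
        ((integral_norm_le_of_bracket_pow_mul_le (H ξ rfl φ A φ.2.1 hA)).trans_eq (by ring))⟩
    cases t with
    | beurling => exact key
    | roumieu => exact key

theorem fourierFunctional_apply {M : WeightSequence} {t : Kind} {f : (Fin d → ℂ) → ℂ}
    {ξ : Rd d} (h : GrowthOn M t {ξ} f) (hf : Continuous fun η => f (cpoint ξ η))
    (φ : SSpace M t d) :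
    (fourierFunctional h hf).toFun φ = ∫ η, f (cpoint ξ η) * invFourier φ η := rfl

theorem fourierEq_fourierFunctional {M : WeightSequence} {t : Kind} {f : (Fin d → ℂ) → ℂ}
    {ξ : Rd d} (h : GrowthOn M t {ξ} f) (hf : Continuous fun η => f (cpoint ξ η)) :
    FourierEq (fourierFunctional h hf) (fun η => f (cpoint ξ η)) := by
  refine ⟨hf, fun ψ => ?_⟩
  have hF := fourier_mem_SSpace ψ.2
  -- Since F⁻¹Fψ = ψ, the functional evaluated at Fψ is the integral of f(ξ + i·)ψ.
  have hinv : invFourier (fourier (ψ : Rd d → ℂ)) = ψ := invFourier_fourier ψ.2.1.continuous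
    (integrable_of_mem_SSpace ψ.2) (integrable_of_mem_SSpace hF)
  have hint := h.integrable (Set.mem_singleton ξ) hf hF
  refine ⟨?_, ?_⟩
  · simpa only [hinv] using hint
  refine ⟨hF, ?_⟩
  refine (fourierFunctional_apply h hf _).trans ?_
  simp only [hinv]

theorem expMul_add (ξ : Rd d) (φ ψ : Rd d → ℂ) :
    expMul ξ (φ + ψ) = expMul ξ φ + expMul ξ ψ := by
  ext x
  simp [expMul, mul_add]

theorem expMul_smul (ξ : Rd d) (c : ℂ) (φ : Rd d → ℂ) : expMul ξ (c • φ) = c • expMul ξ φ := by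
  ext x
  simp [expMul, mul_left_comm]

theorem expMul_neg_expMul (ξ : Rd d) (φ : Rd d → ℂ) : expMul (-ξ) (expMul ξ φ) = φ := by
  ext x
  simp only [expMul, ← mul_assoc, ← Complex.ofReal_mul, ← Real.exp_add]
  simp

theorem expMul_neg_mem_SSpace {M : WeightSequence} {t : Kind} (ξ : Rd d) (φ : DSpace M t d) :
    expMul (-ξ) (φ : Rd d → ℂ) ∈ SSpace M t d :=
  mem_SSpace_of_mem_DSpace (expMul_mem_DSpace _ φ.2)

/-- The ultradistribution `φ ↦ ∫ f(ξ + iη) (F⁻¹ (e^{x·ξ} φ))(η) dη`. -/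
def laplaceInverse {M : WeightSequence} {t : Kind} {f : (Fin d → ℂ) → ℂ} {ξ : Rd d}
    (h : GrowthOn M t {ξ} f) (hf : Continuous fun η => f (cpoint ξ η)) :
    Ultradistribution M t d where
  toFun :=
    { toFun := fun φ => (fourierFunctional h hf).toFun ⟨_, expMul_neg_mem_SSpace ξ φ⟩
      map_add' := fun φ ψ => by
        rw [← map_add]
        congr 1
        exact Subtype.ext (expMul_add _ _ _)
      map_smul' := fun c φ => by
        rw [RingHom.id_apply, ← map_smul]
        congr 1
        exact Subtype.ext (expMul_smul _ _ _) }
  cont := by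
    have key : ∀ K : Set (Rd d), IsCompact K → ForIndex t fun m => ∃ C, ∀ φ : DSpace M t d,
        tsupport (φ : Rd d → ℂ) ⊆ K → ∀ A, DNormLE M m A (φ : Rd d → ℂ) →
        ‖∫ η, f (cpoint ξ η) * invFourier (expMul (-ξ) φ) η‖ ≤ C * A := by
      intro K hK
      obtain ⟨R, hR⟩ := hK.isBounded.subset_closedBall 0
      refine (h.dNorm_bound (le_max_right R 0) (norm_nonneg ξ)
        (by rintro _ rfl; exact le_rfl)).map_mul one_pos fun m hm => ?_
      rw [one_mul]
      rintro ⟨C, -, H⟩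
      refine ⟨C * bracketIntegral d, fun φ hφ A hA => (norm_integral_le_integral_norm _).trans
        ((integral_norm_le_of_bracket_pow_mul_le (H ξ rfl φ A φ.2.1 ((hφ.trans hR).trans
          (Metric.closedBall_subset_closedBall (le_max_left _ _))) hA)).trans_eq (by ring))⟩
    cases t with
    | beurling => exact key
    | roumieu => exact key

/-! ### Holomorphy and the shift of the contour. -/

/-- The Laplace transform `∫ e^{x·ζ} φ(x) dx`. -/
def laplace (φ : Rd d → ℂ) (ζ : Fin d → ℂ) : ℂ :=
  ∫ x : Rd d, Complex.exp (∑ j, (x j : ℂ) * ζ j) * φ x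

/-- This exhibits the integrand as the restriction of a function holomorphic in ξ + iη, which is
what allows ξ to be moved. -/
theorem invFourier_expMul_neg (φ : Rd d → ℂ) (ξ η : Rd d) :
    invFourier (expMul (-ξ) φ) η = ((2 * Real.pi : ℂ) ^ d)⁻¹ * laplace φ (cpoint ξ η) := by
  rw [invFourier, fourier, laplace]
  congr 2 with x
  rw [expMul, ← mul_assoc, Complex.ofReal_exp, ← Complex.exp_add]
  congr 2
  simp only [PiLp.inner_apply, RCLike.inner_apply, conj_trivial, cpoint, PiLp.neg_apply]
  push_cast
  rw [Finset.mul_sum, ← Finset.sum_neg_distrib, ← Finset.sum_add_distrib]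
  exact Finset.sum_congr rfl fun j _ => by ring

theorem differentiable_integral_exp_mul {φ : Rd d → ℂ} (hφ : Continuous φ)
    (hs : HasCompactSupport φ) {a b : Rd d → ℂ} (ha : Continuous a) (hb : Continuous b) :
    Differentiable ℂ fun w : ℂ => ∫ x, Complex.exp (a x + w * b x) * φ x := by
  intro w₀
  have hcs : ∀ g : Rd d → ℂ, Continuous g → Integrable fun x => g x * φ x := fun g hg =>
    (hg.mul hφ).integrable_of_hasCompactSupport hs.mul_left
  have hbound : Integrable fun x : Rd d =>
      ‖((‖b x‖ * Real.exp (‖a x‖ + (‖w₀‖ + 1) * ‖b x‖) : ℝ) : ℂ) * φ x‖ :=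
    (hcs _ (by fun_prop)).norm
  refine (hasDerivAt_integral_of_dominated_loc_of_deriv_le (Metric.ball_mem_nhds w₀ one_pos)
    (F := fun w x => Complex.exp (a x + w * b x) * φ x)
    (F' := fun w x => Complex.exp (a x + w * b x) * b x * φ x)
    (Filter.Eventually.of_forall fun w => (hcs _ (by fun_prop)).aestronglyMeasurable)
    (hcs _ (by fun_prop)) (hcs _ (by fun_prop)).aestronglyMeasurable
    (Filter.Eventually.of_forall fun x w hw => ?_) hbound
    (Filter.Eventually.of_forall fun x w _ => ?_)).2.differentiableAt
  · have hw' : ‖w‖ ≤ ‖w₀‖ + 1 := by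
      have h1 := norm_add_le w₀ (w - w₀)
      have h2 : ‖w - w₀‖ < 1 := by simpa [dist_eq_norm] using hw
      rw [add_sub_cancel] at h1
      linarith
    rw [norm_mul, norm_mul, norm_mul, Complex.norm_real, Real.norm_of_nonneg (by positivity),
      mul_comm ‖b x‖, Complex.norm_exp]
    gcongr
    refine (Complex.re_le_norm _).trans ((norm_add_le _ _).trans ?_)
    rw [norm_mul]
    gcongr
  · have h1 : HasDerivAt (fun w : ℂ => a x + w * b x) (b x) w := by
      simpa using ((hasDerivAt_id w).mul_const (b x)).const_add (a x)
    exact (h1.cexp).mul_const (φ x)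

theorem cpoint_add_smul (ξ η v : Rd d) (w : ℂ) :
    cpoint (ξ + w.re • v) (η + w.im • v) = cpoint ξ η + w • fun j => (v j : ℂ) := by
  ext j
  simp only [cpoint, PiLp.add_apply, PiLp.smul_apply, smul_eq_mul, Pi.add_apply, Pi.smul_apply]
  conv_rhs => rw [← Complex.re_add_im w]
  push_cast
  ring

theorem differentiable_laplace_line {φ : Rd d → ℂ} (hφ : Continuous φ)
    (hs : HasCompactSupport φ) (ζ v : Fin d → ℂ) :
    Differentiable ℂ fun w : ℂ => laplace φ (ζ + w • v) := by
  have h := differentiable_integral_exp_mul hφ hs (a := fun x => ∑ j, (x j : ℂ) * ζ j)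
    (b := fun x => ∑ j, (x j : ℂ) * v j) (by fun_prop) (by fun_prop)
  convert h using 2 with w
  refine integral_congr_ae (Filter.Eventually.of_forall fun x => ?_)
  simp only [Pi.add_apply, Pi.smul_apply, smul_eq_mul, Finset.mul_sum, ← Finset.sum_add_distrib]
  congr 2
  exact Finset.sum_congr rfl fun j _ => by ring

/-- The integral of a holomorphic family of functions with a uniform bound is holomorphic. -/
theorem differentiableOn_integral_of_norm_le {α : Type*} [MeasurableSpace α] {μ : Measure α}
    {F : ℂ → α → ℂ} {bound : α → ℝ} {U : Set ℂ} (hU : IsOpen U)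
    (hm : ∀ w ∈ U, AEStronglyMeasurable (F w) μ) (hb : Integrable bound μ)
    (hle : ∀ w ∈ U, ∀ a, ‖F w a‖ ≤ bound a)
    (hd : ∀ a, DifferentiableOn ℂ (fun w => F w a) U) :
    DifferentiableOn ℂ (fun w => ∫ a, F w a ∂μ) U := by
  intro w₀ hw₀
  obtain ⟨r, hr, hball⟩ := Metric.isOpen_iff.1 hU w₀ hw₀
  -- Since 1/2 + 1/3 < 1, discs of radius r/3 about points of the half ball stay in U, and Cauchy's
  -- estimate bounds the derivative there by `bound a / (r / 3)`.
  have hsub : ∀ w ∈ Metric.ball w₀ (r / 2), Metric.closedBall w (r / 3) ⊆ U := by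
    intro w hw z hz
    refine hball ?_
    rw [Metric.mem_ball] at hw ⊢
    rw [Metric.mem_closedBall] at hz
    linarith [dist_triangle z w w₀]
  have hder : ∀ a, ∀ w ∈ U, HasDerivAt (fun w => F w a) (deriv (fun w => F w a) w) w :=
    fun a w hw => ((hd a).differentiableAt (hU.mem_nhds hw)).hasDerivAt
  refine (hasDerivAt_integral_of_dominated_loc_of_deriv_le
    (Metric.ball_mem_nhds w₀ (half_pos hr)) (F := F) (bound := fun a => bound a / (r / 3))
    (F' := fun w a => deriv (fun w => F w a) w)
    (Filter.eventually_of_mem (hU.mem_nhds hw₀) hm)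
    (hb.mono' (hm w₀ hw₀) (Filter.Eventually.of_forall (hle w₀ hw₀))) ?_
    (Filter.Eventually.of_forall fun a w hw => ?_) (hb.div_const _)
    (Filter.Eventually.of_forall fun a w hw => hder a w
      (hsub w hw (Metric.mem_closedBall_self (by positivity))))).2.differentiableAt
      |>.differentiableWithinAt
  -- Measurability of the derivative in the parameter: it is a pointwise limit of difference
  -- quotients along a sequence of steps tending to 0.
  · have ht : Filter.Tendsto (fun n : ℕ => ((r / 2 * (1 / ((n : ℝ) + 1)) : ℝ) : ℂ)) Filter.atTop
        (nhdsWithin 0 {0}ᶜ) := by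
      refine tendsto_nhdsWithin_iff.2 ⟨?_, Filter.Eventually.of_forall fun n => ?_⟩
      · have := (tendsto_one_div_add_atTop_nhds_zero_nat (𝕜 := ℝ)).const_mul (r / 2)
        rw [mul_zero] at this
        exact_mod_cast (Complex.continuous_ofReal.tendsto _).comp this
      · simp only [Set.mem_compl_iff, Set.mem_singleton_iff, Complex.ofReal_eq_zero]
        positivity
    refine aestronglyMeasurable_of_tendsto_ae Filter.atTop (fun n => ?_)
      (Filter.Eventually.of_forall fun a => (hder a w₀ hw₀).tendsto_slope_zero.comp ht)
    simp only [Function.comp_apply, smul_eq_mul]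
    refine ((hm _ (hball ?_)).sub (hm w₀ hw₀)).const_mul _
    rw [Metric.mem_ball, dist_self_add_left, Complex.norm_real, Real.norm_of_nonneg (by positivity)]
    have : 1 / ((n : ℝ) + 1) ≤ 1 :=
      (div_le_one (by positivity)).2 (by linarith [n.cast_nonneg (α := ℝ)])
    nlinarith
  · refine Complex.norm_deriv_le_of_forall_mem_sphere_norm_le (by positivity) ?_ fun z hz =>
      hle z (hsub w hw (Metric.sphere_subset_closedBall hz)) a
    exact ((hd a).mono ((closure_mono Metric.ball_subset_closedBall).trans
      (Metric.isClosed_closedBall.closure_eq.subset.trans (hsub w hw)))).diffContOnCl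

/-- Difference quotients along the imaginary steps i/(n + 1) all vanish, and complex
differentiability makes them converge to the derivative. -/
theorem deriv_eq_zero_of_forall_re_eq {I : ℂ → ℂ} (h : ∀ w, I w = I w.re) {w : ℂ}
    (hd : DifferentiableAt ℂ I w) : deriv I w = 0 := by
  have ht : Filter.Tendsto (fun n : ℕ => ((1 / ((n : ℝ) + 1) : ℝ) : ℂ) * Complex.I) Filter.atTop
      (nhdsWithin 0 {0}ᶜ) := by
    refine tendsto_nhdsWithin_iff.2 ⟨?_, Filter.Eventually.of_forall fun n => ?_⟩
    · have := (Complex.continuous_ofReal.tendsto _).comp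
        (tendsto_one_div_add_atTop_nhds_zero_nat (𝕜 := ℝ))
      simpa using this.mul_const Complex.I
    · simp only [Set.mem_compl_iff, Set.mem_singleton_iff, mul_eq_zero, Complex.ofReal_eq_zero,
        Complex.I_ne_zero, or_false]
      positivity
  refine tendsto_nhds_unique (hd.hasDerivAt.tendsto_slope_zero.comp ht) ?_
  refine tendsto_const_nhds.congr fun n => ?_
  simp only [Function.comp_apply]
  rw [h w, h (w + _)]
  simp

/-- Shifting the contour of integration in a tube. -/
theorem integral_cpoint_add_eq {G : (Fin d → ℂ) → ℂ} {ξ v : Rd d} {C : ℝ}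
    (hd : ∀ η, DifferentiableOn ℂ (fun w : ℂ => G (cpoint ξ η + w • fun j => (v j : ℂ)))
      (Metric.ball 0 2))
    (hc : ∀ w ∈ Metric.ball (0 : ℂ) 2, Continuous fun η => G (cpoint (ξ + w.re • v) η))
    (hle : ∀ w ∈ Metric.ball (0 : ℂ) 2, ∀ η,
      bracket η ^ (d + 1) * ‖G (cpoint (ξ + w.re • v) η)‖ ≤ C) :
    ∫ η, G (cpoint (ξ + v) η) = ∫ η, G (cpoint ξ η) := by
  set F : ℂ → Rd d → ℂ := fun w η => G (cpoint (ξ + w.re • v) (η + w.im • v)) with hF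
  -- Im w only translates the variable η.
  have hIre : ∀ w : ℂ, ∫ η, F w η = ∫ η, F w.re η := by
    intro w
    simp only [hF, Complex.ofReal_re, Complex.ofReal_im, zero_smul, add_zero]
    exact integral_add_right_eq_self (fun η => G (cpoint (ξ + w.re • v) η)) (w.im • v)
  have hdiff : DifferentiableOn ℂ (fun w => ∫ η, F w η) (Metric.ball 0 2) := by
    refine differentiableOn_integral_of_norm_le Metric.isOpen_ball
      (bound := fun η => C * (1 + 2 * ‖v‖) ^ (d + 1) * (bracket η ^ (d + 1))⁻¹)
      (fun w hw => ((hc w hw).comp (continuous_add_const _)).aestronglyMeasurable)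
      (integrable_inv_bracket_pow.const_mul _) (fun w hw η => ?_) (fun η => ?_)
    · refine norm_le_mul_inv_bracket_pow (g := F w) (fun η => ?_) η
      have h1 := bracket_le_mul_bracket_add η (w.im • v)
      have h2 := hle w hw (η + w.im • v)
      have h3 : ‖w.im • v‖ ≤ 2 * ‖v‖ := by
        rw [norm_smul]
        have : ‖w‖ < 2 := by simpa using hw
        gcongr
        exact (Complex.abs_im_le_norm w).trans this.le
      have hJ := bracket_pos η
      have hJ' := bracket_pos (η + w.im • v)
      calc bracket η ^ (d + 1) * ‖F w η‖
          ≤ ((1 + 2 * ‖v‖) * bracket (η + w.im • v)) ^ (d + 1) * ‖F w η‖ := by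
            gcongr
            exact h1.trans (by gcongr)
        _ = (1 + 2 * ‖v‖) ^ (d + 1) * (bracket (η + w.im • v) ^ (d + 1) * ‖F w η‖) := by
            rw [mul_pow, mul_assoc]
        _ ≤ (1 + 2 * ‖v‖) ^ (d + 1) * C := by gcongr
        _ = _ := by ring
    · simpa only [hF, cpoint_add_smul] using hd η
  -- The radius 2 places both endpoints w = 0 and w = 1 inside an open connected set.
  have hconst := Metric.isOpen_ball.is_const_of_deriv_eq_zero
    (convex_ball (0 : ℂ) 2).isPreconnected hdiff
    (fun w hw => deriv_eq_zero_of_forall_re_eq hIre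
      (hdiff.differentiableAt (Metric.isOpen_ball.mem_nhds hw)))
    (x := 1) (y := 0) (by simp) (by simp)
  simpa [hF] using hconst

theorem laplace_integral_eq {M : WeightSequence} {t : Kind} {B : Set (Rd d)}
    (hBo : IsOpen B) (hBc : IsPreconnected B) {f : (Fin d → ℂ) → ℂ}
    (hf : AnalyticOnNhd ℂ f (tube B)) (hgrowth : GrowthCondition M t B f) (φ : DSpace M t d)
    {ξ ξ' : Rd d} (hξ : ξ ∈ B) (hξ' : ξ' ∈ B) :
    ∫ η, f (cpoint ξ η) * invFourier (expMul (-ξ) φ) η =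
      ∫ η, f (cpoint ξ' η) * invFourier (expMul (-ξ') φ) η := by
  refine hBc.induction₂ (fun ξ ξ' => ∫ η, f (cpoint ξ η) * invFourier (expMul (-ξ) φ) η =
      ∫ η, f (cpoint ξ' η) * invFourier (expMul (-ξ') φ) η) (fun ξ hξ => ?_)
      (fun _ _ _ _ _ _ h1 h2 => h1.trans h2) (fun _ _ _ _ h => h.symm) hξ hξ'
  obtain ⟨r, hr, hball⟩ := Metric.isOpen_iff.1 hBo ξ hξ
  have hK : Metric.closedBall ξ (r / 2) ⊆ B :=
    (Metric.closedBall_subset_ball (half_lt_self hr)).trans hball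
  obtain ⟨R, hR, hsupp⟩ := hasCompactSupport_exists_closedBall φ.2.2.1
  obtain ⟨h, -, ⟨C, -, hC⟩, A, hA⟩ := ((hgrowth.growthOn (isCompact_closedBall ξ (r / 2))
    hK).dNorm_bound hR (R' := ‖ξ‖ + r / 2) (by positivity) (fun x hx => by
      have := norm_le_norm_add_norm_sub ξ x
      rw [mem_closedBall_iff_norm'] at hx
      linarith)).exists_dNormLE φ.2.2.2
  refine Filter.Eventually.filter_mono nhdsWithin_le_nhds ?_
  -- With |v| < r/4 and |w| < 2, the points ξ + (Re w)v stay in the closed ball of radius r/2, a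
  -- compact subset of B on which the growth bound is uniform.
  filter_upwards [Metric.ball_mem_nhds ξ (show 0 < r / 4 by positivity)] with y hy
  obtain ⟨v, rfl⟩ : ∃ v, y = ξ + v := ⟨y - ξ, by abel⟩
  have hv : ‖v‖ < r / 4 := by simpa using hy
  have hmem : ∀ w ∈ Metric.ball (0 : ℂ) 2, ξ + w.re • v ∈ Metric.closedBall ξ (r / 2) := by
    intro w hw
    have hw' : ‖w‖ < 2 := by simpa using hw
    rw [mem_closedBall_iff_norm, add_sub_cancel_left, norm_smul]
    have := (Complex.abs_re_le_norm w).trans hw'.le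
    rw [Real.norm_eq_abs]
    nlinarith [norm_nonneg v]
  simp only [invFourier_expMul_neg] at hC ⊢
  refine (integral_cpoint_add_eq
    (G := fun ζ => f ζ * (((2 * Real.pi : ℂ) ^ d)⁻¹ * laplace φ ζ))
    (fun η => ?_) (fun w hw => ?_) (fun w hw η => hC _ (hmem w hw) φ A φ.2.1 hsupp hA η)).symm
  · refine DifferentiableOn.mul (fun w hw => ?_) ((differentiable_laplace_line φ.2.1.continuous
      φ.2.2.1 _ _).const_mul _).differentiableOn
    have hz : cpoint ξ η + w • (fun j => (v j : ℂ)) ∈ tube B :=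
      ⟨_, hK (hmem w hw), η + w.im • v, (cpoint_add_smul _ _ _ _).symm⟩
    have h1 := (hf _ hz).differentiableAt
    exact (h1.comp w (f := fun w : ℂ => cpoint ξ η + w • fun j => (v j : ℂ))
      (by fun_prop)).differentiableWithinAt
  · have h1 : Continuous fun η => f (cpoint (ξ + w.re • v) η) :=
      continuous_iff_continuousAt.2 fun η => ContinuousAt.comp
        (hf _ ⟨_, hK (hmem w hw), η, rfl⟩).continuousAt (continuous_cpoint _).continuousAt
    have h2 := continuous_invFourier (expMul_neg_mem_SSpace (ξ + w.re • v) φ)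
    simp only [← invFourier_expMul_neg]
    exact h1.mul h2

end Ultra

end

theorem theorem2 (d : ℕ) (M : Ultra.WeightSequence) (t : Ultra.Kind)
    (B : Set (Ultra.Rd d)) (hBo : IsOpen B) (hBc : IsPreconnected B)
    (f : (Fin d → ℂ) → ℂ) (hf : AnalyticOnNhd ℂ f (Ultra.tube B))
    (hgrowth : Ultra.GrowthCondition M t B f) :
    ∃ S : Ultra.Ultradistribution M t d, ∀ ξ ∈ B,
      ∃ T : Ultra.TemperedUltradistribution M t d,
        Ultra.IsExpMul ξ S T ∧ Ultra.FourierEq T (fun η => f (Ultra.cpoint ξ η)) := by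
  have hc : ∀ ξ ∈ B, Continuous fun η => f (Ultra.cpoint ξ η) := fun ξ hξ =>
    continuous_iff_continuousAt.2 fun η => ContinuousAt.comp
      (hf _ ⟨ξ, hξ, η, rfl⟩).continuousAt (Ultra.continuous_cpoint _).continuousAt
  have hg : ∀ ξ ∈ B, Ultra.GrowthOn M t {ξ} f := fun ξ hξ =>
    hgrowth.growthOn isCompact_singleton (Set.singleton_subset_iff.2 hξ)
  -- For empty B there is no base point, and any S works.
  rcases B.eq_empty_or_nonempty with rfl | ⟨ξ₀, hξ₀⟩
  · refine ⟨⟨0, ?_⟩, fun ξ hξ => hξ.elim⟩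
    cases t with
    | beurling => exact fun K _ => ⟨1, one_pos, 0, by simp⟩
    | roumieu => exact fun K _ h _ => ⟨0, by simp⟩
  refine ⟨Ultra.laplaceInverse (hg ξ₀ hξ₀) (hc ξ₀ hξ₀), fun ξ hξ =>
    ⟨Ultra.fourierFunctional (hg ξ hξ) (hc ξ hξ), fun φ =>
      ⟨Ultra.mem_SSpace_of_mem_DSpace φ.2, Ultra.expMul_mem_DSpace ξ φ.2, ?_⟩,
      Ultra.fourierEq_fourierFunctional _ _⟩⟩
  -- Independence of the base point is applied to e^{-x·ξ}φ: at ξ the exponentials cancel and T_ξ(φ)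
  -- remains, while at ξ₀ the integral is S(e^{-x·ξ}φ).
  have h := Ultra.laplace_integral_eq hBo hBc hf hgrowth
    ⟨_, Ultra.expMul_mem_DSpace ξ φ.2⟩ hξ hξ₀
  simp only [Ultra.expMul_neg_expMul] at h
  exact h
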